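/- **Proposition 3.4 (Parabolic multiscale Poincaré inequality).** Let $d\ge 2$. For $n\in\mathbb N$ put $I_n=(-\tfrac{3^{2n}}2,\tfrac{3^{2n}}2)$, $\square_n=(-\tfrac{3^n}2,\tfrac{3^n}2)^d$, $\boxdot_n=I_n\times\square_n\subset\mathbb R\times\mathbb R^d$, and for $m\le n$ put $\mathcal Z_m=\big[(3^{2m}\mathbb Z)\times(3^m\mathbb Z^d)\big]\cap\boxdot_n$ (a finite set, with $|\mathcal Z_m|$ elements). Write $(f)_V=\frac1{|V|}\int_V f$ and $\|f\|_{\underline L^2(V)}=\big(\frac1{|V|}\int_V |f|^2\big)^{1/2}$. For a bounded interval $I$ and a bounded Lipschitz domain $U\subset\mathbb R^d$ let $$\|u\|_{\underline H^1(U)}=|U|^{-1/d}\|u\|_{\underline L^2(U)}+\|\nabla u\|_{\underline L^2(U)},\qquad \|v\|_{\underline H^{-1}(U)}=\sup\Big\{\frac1{|U|}\int_U uv:\ u\in H^1_0(U),\ \|u\|_{\underline H^1(U)}\le1\Big\},$$ where $H^1_0(U)$ is the closure of $C_c^\infty(U)$ in $H^1(U)$, $H^{-1}(U)$ is its dual,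 and $\int_U uv$ denotes the duality pairing of $v\in H^{-1}(U)$ with $u$. Let $H^1_{\mathrm{par}}(I\times U)=\{w\in L^2(I;H^1(U)):\partial_t w\in L^2(I;H^{-1}(U))\}$, with $$\|w\|_{\underline H^1_{\mathrm{par}}(I\times U)}=\Big(\frac1{|I|}\int_I \|w(t,\cdot)\|_{\underline H^1(U)}^2dt\Big)^{1/2}+\Big(\frac1{|I|}\int_I \|\partial_t w(t,\cdot)\|_{\underline H^{-1}(U)}^2dt\Big)^{1/2},$$ and, for $f\in L^2(I\times U)$, $$\|f\|_{\underline{\hat H}^{-1}_{\mathrm{par}}(I\times U)}=\sup\Big\{\frac1{|I\times U|}\int_{I\times U}fw:\ w\in H^1_{\mathrm{par}}(I\times U),\ \|w\|_{\underline H^1_{\mathrm{par}}(I\times U)}\le1\Big\}.$$ There exists a constant $C<\infty$, depending only on $d$, such that, for every integer $n\ge1$ and every $f\in L^2(\boxdot_n)$, $$\|f\|_{\underline{\hat H}^{-1}_{\mathrm{par}}(\boxdot_n)}\le C\,\|f\|_{\underline L^2(\boxdot_n)}+C\sum_{m=0}^{n-1}3^m\Big(|\mathcal Z_m|^{-1}\sum_{z\in\mathcal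 Z_m}\big|(f)_{z+\boxdot_m}\big|^2\Big)^{1/2}.$$ -/

import Mathlib

open MeasureTheory Set
open scoped ENNReal NNReal ContDiff

noncomputable section

/-- The space `ℝ^d` with its Euclidean norm and Lebesgue measure. -/
abbrev Space (d : ℕ) : Type := EuclideanSpace ℝ (Fin d)

/-- Space-time `ℝ × ℝ^d`; its `volume` is the product Lebesgue measure. -/
abbrev SpaceTime (d : ℕ) : Type := ℝ × Space d

/-! ### Triadic cubes and parabolic cylinders -/

/-- The time interval `I_n = (-3^{2n}/2, 3^{2n}/2)`. -/
def timeInterval (n : ℕ) : Set ℝ := Ioo (-((3 : ℝ) ^ (2 * n) / 2)) ((3 : ℝ) ^ (2 * n) / 2)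

/-- The spatial cube `□_n = (-3^n/2, 3^n/2)^d`. -/
def spaceCube (d n : ℕ) : Set (Space d) :=
  {x | ∀ i, x i ∈ Ioo (-((3 : ℝ) ^ n / 2)) ((3 : ℝ) ^ n / 2)}

/-- The parabolic cylinder `I_n × □_n`. -/
def parCyl (d n : ℕ) : Set (SpaceTime d) := timeInterval n ×ˢ spaceCube d n

/-- The translate `z + V`. -/
def shift {d : ℕ} (z : SpaceTime d) (V : Set (SpaceTime d)) : Set (SpaceTime d) :=
  (fun p => z + p) '' V

/-- `Z_m = (3^{2m} ℤ × 3^m ℤ^d) ∩ (I_n × □_n)`. -/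
def latticePoints (d m n : ℕ) : Set (SpaceTime d) :=
  {z | (∃ k : ℤ, z.1 = (3 : ℝ) ^ (2 * m) * k) ∧ ∀ i, ∃ k : ℤ, z.2 i = (3 : ℝ) ^ m * k} ∩
    parCyl d n

lemma finite_lattice_interval (c r : ℝ) (hc : 0 < c) :
    {x : ℝ | (∃ k : ℤ, x = c * k) ∧ x ∈ Ioo (-r) r}.Finite := by
  refine ((Set.finite_Icc ⌊-r / c⌋ ⌈r / c⌉).image (fun k : ℤ => c * (k : ℝ))).subset ?_
  rintro x ⟨⟨k, rfl⟩, h1, h2⟩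
  refine ⟨k, ⟨?_, ?_⟩, rfl⟩
  · have : -r / c < k := by rw [div_lt_iff₀ hc]; linarith
    exact_mod_cast (Int.floor_le _).trans this.le
  · have : (k : ℝ) < r / c := by rw [lt_div_iff₀ hc]; linarith
    exact_mod_cast this.le.trans (Int.le_ceil _)

lemma latticePoints_finite (d m n : ℕ) : (latticePoints d m n).Finite := by
  have h1 := finite_lattice_interval ((3 : ℝ) ^ (2 * m)) ((3 : ℝ) ^ (2 * n) / 2) (by positivity)
  have h2 := Set.Finite.pi' (fun _ : Fin d =>
    finite_lattice_interval ((3 : ℝ) ^ m) ((3 : ℝ) ^ n / 2) (by positivity))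
  refine (h1.prod (h2.image (WithLp.toLp 2))).subset ?_
  rintro ⟨t, x⟩ ⟨⟨ht, hx⟩, ht', hx'⟩
  exact ⟨⟨ht, ht'⟩, ⟨x.ofLp, fun i => ⟨hx i, hx' i⟩, rfl⟩⟩

/-! ### Normalized norms, test functions, weak gradients -/

/-- The normalized norm `‖f‖_{L²(V)} = (⨍_V |f|²)^{1/2}`. -/
def normL2 {X F : Type*} [MeasureSpace X] [NormedAddCommGroup F] (V : Set X) (f : X → F) :
    ℝ≥0∞ :=
  (⨍⁻ x in V, ‖f x‖ₑ ^ 2 ∂volume) ^ (1 / 2 : ℝ)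

/-- `φ ∈ C_c^∞(U)`. -/
def IsTestFunction {X : Type*} [NormedAddCommGroup X] [NormedSpace ℝ X] (U : Set X)
    (φ : X → ℝ) : Prop :=
  ContDiff ℝ ∞ φ ∧ HasCompactSupport φ ∧ tsupport φ ⊆ U

/-- `G` is the weak gradient of `u` in `U` (for `u`, `G` locally integrable in `U`). -/
def HasWeakGradient {d : ℕ} (U : Set (Space d)) (u : Space d → ℝ) (G : Space d → Space d) :
    Prop :=
  ∀ φ : Space d → ℝ, IsTestFunction U φ →
    ∫ x in U, u x • gradient φ x = -∫ x in U, φ x • G x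

/-- The normalized norm `‖u‖_{H¹(U)} = |U|^{-1/d} ‖u‖_{L²(U)} + ‖∇u‖_{L²(U)}` of a function `u`
with weak gradient `G`. -/
def normH1 {d : ℕ} (U : Set (Space d)) (u : Space d → ℝ) (G : Space d → Space d) : ℝ≥0∞ :=
  (volume U) ^ (-(1 / (d : ℝ))) * normL2 U u + normL2 U G

/-! ### The spaces `H¹_0(U)` and `H^{-1}(U)` -/

/-- The Hilbert space `L²(U) × L²(U; ℝ^d)`, in which `H¹(U)` embeds by `u ↦ (u, ∇u)`. -/
abbrev L2Pair {d : ℕ} (U : Set (Space d)) : Type :=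
  WithLp 2 (Lp ℝ 2 (volume.restrict U) × Lp (Space d) 2 (volume.restrict U))

/-- `H¹_0(U)`, the closure of `C_c^∞(U)` for the `H¹` norm; an element is a pair `(u, ∇u)`. -/
def H10 {d : ℕ} (U : Set (Space d)) : Submodule ℝ (L2Pair U) :=
  (Submodule.span ℝ {p : L2Pair U | ∃ φ : Space d → ℝ, IsTestFunction U φ ∧
    p.fst =ᵐ[volume.restrict U] φ ∧ p.snd =ᵐ[volume.restrict U] gradient φ}).topologicalClosure

/-- `H^{-1}(U)`, the dual space of `H¹_0(U)`. The functional of a function `v` is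
`u ↦ ∫_U u v`. -/
abbrev Hminus1 {d : ℕ} (U : Set (Space d)) : Type := H10 U →L[ℝ] ℝ

/-- The normalized dual norm
`‖T‖_{H^{-1}(U)} = sup {|U|⁻¹ T(u) : u ∈ H¹_0(U), ‖u‖_{H¹(U)} ≤ 1}`. -/
def normHminus1 {d : ℕ} (U : Set (Space d)) (T : Hminus1 U) : ℝ≥0∞ :=
  ⨆ (u : H10 U) (_ : normH1 U u.1.fst u.1.snd ≤ 1), ENNReal.ofReal ((volume.real U)⁻¹ * T u)

/-! ### The parabolic spaces -/

/-- `w ∈ H¹_par(I × U)`, with spatial gradient `∇w = G` and time derivative `∂ₜw = T`: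
`w ∈ L²(I; H¹(U))` and `T ∈ L²(I; H^{-1}(U))` (a Bochner space) is the distributional derivative
of `t ↦ w(t,·)`. By uniqueness of weak derivatives, `w` determines `G` and `T` almost everywhere. -/
structure IsH1Par {d : ℕ} (I : Set ℝ) (U : Set (Space d)) (w : SpaceTime d → ℝ)
    (G : SpaceTime d → Space d) (T : ℝ → Hminus1 U) : Prop where
  memLp : MemLp w 2 (volume.restrict (I ×ˢ U))
  memLp_grad : MemLp G 2 (volume.restrict (I ×ˢ U))
  hasWeakGradient : ∀ᵐ t ∂(volume.restrict I),
    HasWeakGradient U (fun x => w (t, x)) (fun x => G (t, x))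
  memLp_time : MemLp T 2 (volume.restrict I)
  weak_time : ∀ η : ℝ → ℝ, IsTestFunction I η → ∀ v : H10 U,
    ∫ t in I, η t * T t v = -∫ t in I, deriv η t * ∫ x in U, w (t, x) * v.1.fst x

/-- The normalized norm
`‖w‖_{H¹_par(I × U)} = ‖w‖_{L²(I; H¹(U))} + ‖∂ₜw‖_{L²(I; H^{-1}(U))}`, where `G = ∇w` and
`T = ∂ₜw`. -/
def normH1Par {d : ℕ} (I : Set ℝ) (U : Set (Space d)) (w : SpaceTime d → ℝ)
    (G : SpaceTime d → Space d) (T : ℝ → Hminus1 U) : ℝ≥0∞ :=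
  (⨍⁻ t in I, normH1 U (fun x => w (t, x)) (fun x => G (t, x)) ^ 2 ∂volume) ^ (1 / 2 : ℝ) +
    (⨍⁻ t in I, normHminus1 U (T t) ^ 2 ∂volume) ^ (1 / 2 : ℝ)

/-- The normalized norm of `f` in the dual of `H¹_par(I × U)`:
`sup {⨍_{I × U} f w : w ∈ H¹_par(I × U), ‖w‖_{H¹_par(I × U)} ≤ 1}`. -/
def normHhatMinus1Par {d : ℕ} (I : Set ℝ) (U : Set (Space d)) (f : SpaceTime d → ℝ) : ℝ≥0∞ :=
  ⨆ (w : SpaceTime d → ℝ) (G : SpaceTime d → Space d) (T : ℝ → Hminus1 U)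
    (_ : IsH1Par I U w G T) (_ : normH1Par I U w G T ≤ 1),
    ENNReal.ofReal (⨍ p in I ×ˢ U, f p * w p)

/-- The root mean square `(|Z_m|⁻¹ ∑_{z ∈ Z_m} |(f)_{z + I_m × □_m}|²)^{1/2}` of the averages of `f`
over the subcylinders of scale `m` of `I_n × □_n`. -/
def rmsAverages (d m n : ℕ) (f : SpaceTime d → ℝ) : ℝ :=
  Real.sqrt (((latticePoints_finite d m n).toFinset.card : ℝ)⁻¹ *
    ∑ z ∈ (latticePoints_finite d m n).toFinset, |⨍ p in shift z (parCyl d m), f p| ^ 2)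

end

/-! Fix `w` in the unit ball of H¹_par. For each scale `m < n` there is a function `g m`, constant
on the parabolic cells of scale `m`, whose normalized L² distance to `w` is at most a constant times
`3 ^ m`. At scale `n` one may take `g n = 0`: the factor `|U|^{-1/d}` in the H¹ norm already bounds
the L² norm of `w` by `3 ^ n`. Decompose `w = (w - g 0) + ∑ (g m - g (m + 1))` over `m < n`. The
first term has size O(1) and is paired with `f` by Cauchy–Schwarz, which gives the L² term. Since
cells are nested, `g m - g (m + 1)` is constant on cells of scale `m`; its pairing with `f` only
sees the averages of `f` over these cells (`enorm_setAverage_mul_cell_constant_le`), and its size is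
of order `3 ^ m`.

The approximation, `exists_cell_approximation`, is a parabolic Poincaré inequality. On the spatial
cell `k`, replace `w(t, ·)` by `F k t = ∫ w(t, x) ψ k x dx`, where `ψ k` is a bump of integral one
supported in the cell; the gradient controls the error. A smooth bump is used instead of the
normalized indicator because `∂ₜw` only acts on H¹₀: it makes the time derivative of `F k` equal to
the pairing of `∂ₜw` with `ψ k`. Then `F k` is replaced by its averages over time intervals of
length `3 ^ (2 * m)`. Bounding each pairing separately would be too lossy after summing over `k`;
`sum_sq_apply_le` bounds the sum of their squares at once, by duality and disjointness of supports.

The Poincaré inequalities in space and in time both come from `lintegral_translate_sub_sq_le`: a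
bound on the weak directional derivative bounds differences of `u` under translation, and
integrating over all translations compares `u` with any weighted average. -/

noncomputable section

/-! ### Square integrals -/

section SquareIntegrals

variable {X F : Type*} [MeasurableSpace X] {μ : Measure X} [NormedAddCommGroup F]

lemma eLpNorm_two_sq (f : X → F) : eLpNorm f 2 μ ^ 2 = ∫⁻ x, ‖f x‖ₑ ^ 2 ∂μ := by
  have h := eLpNorm_nnreal_pow_eq_lintegral (μ := μ) (f := f) (p := 2) two_ne_zero
  simpa using h

lemma lintegral_enorm_sq_ne_top {f : X → F} (hf : MemLp f 2 μ) : ∫⁻ x, ‖f x‖ₑ ^ 2 ∂μ ≠ ⊤ := by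
  rw [← eLpNorm_two_sq]
  exact ENNReal.pow_ne_top hf.2.ne

lemma memLp_two_of_lintegral_ne_top {f : X → F} (hf : AEStronglyMeasurable f μ)
    (h : ∫⁻ x, ‖f x‖ₑ ^ 2 ∂μ ≠ ⊤) : MemLp f 2 μ := by
  refine ⟨hf, lt_top_iff_ne_top.2 fun h' => h ?_⟩
  rw [← eLpNorm_two_sq, h']
  simp

lemma rpow_half_sq (a : ℝ≥0∞) : (a ^ (1 / 2 : ℝ)) ^ 2 = a := by
  rw [← ENNReal.rpow_natCast, ← ENNReal.rpow_mul]
  norm_num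

lemma sq_rpow_half (a : ℝ≥0∞) : (a ^ 2) ^ (1 / 2 : ℝ) = a := by
  rw [← ENNReal.rpow_natCast, ← ENNReal.rpow_mul]
  norm_num

/-- The Cauchy–Schwarz inequality. -/
lemma lintegral_mul_sq_le {f g : X → ℝ≥0∞} (hf : AEMeasurable f μ) (hg : AEMeasurable g μ) :
    (∫⁻ x, f x * g x ∂μ) ^ 2 ≤ (∫⁻ x, f x ^ 2 ∂μ) * ∫⁻ x, g x ^ 2 ∂μ := by
  have h := ENNReal.lintegral_mul_le_Lp_mul_Lq μ Real.HolderConjugate.two_two hf hg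
  have h' : (∫⁻ x, f x * g x ∂μ) ^ 2 ≤ _ := pow_le_pow_left' h 2
  rw [mul_pow, rpow_half_sq, rpow_half_sq] at h'
  simpa using h'

lemma enorm_integral_mul_sq_le {f g : X → ℝ} (hf : AEStronglyMeasurable f μ)
    (hg : AEStronglyMeasurable g μ) :
    ‖∫ x, f x * g x ∂μ‖ₑ ^ 2 ≤ (∫⁻ x, ‖f x‖ₑ ^ 2 ∂μ) * ∫⁻ x, ‖g x‖ₑ ^ 2 ∂μ := by
  refine le_trans ?_ (lintegral_mul_sq_le hf.enorm hg.enorm)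
  gcongr
  refine (enorm_integral_le_lintegral_enorm _).trans_eq ?_
  simp_rw [enorm_mul]

lemma enorm_integral_inner_sq_le {E : Type*} [NormedAddCommGroup E] [InnerProductSpace ℝ E]
    {f g : X → E} (hf : AEStronglyMeasurable f μ) (hg : AEStronglyMeasurable g μ) :
    ‖∫ x, inner ℝ (f x) (g x) ∂μ‖ₑ ^ 2 ≤ (∫⁻ x, ‖f x‖ₑ ^ 2 ∂μ) * ∫⁻ x, ‖g x‖ₑ ^ 2 ∂μ := by
  refine le_trans ?_ (lintegral_mul_sq_le hf.enorm hg.enorm)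
  gcongr
  refine (enorm_integral_le_lintegral_enorm _).trans (lintegral_mono fun x => ?_)
  rw [← ofReal_norm, ← ofReal_norm, ← ofReal_norm,
    ← ENNReal.ofReal_mul (norm_nonneg _)]
  exact ENNReal.ofReal_le_ofReal (norm_inner_le_norm _ _)

lemma enorm_add_sq_le (a b : F) : ‖a + b‖ₑ ^ 2 ≤ 2 * ‖a‖ₑ ^ 2 + 2 * ‖b‖ₑ ^ 2 := by
  have h : ‖a + b‖ₑ ^ 2 ≤ (‖a‖ₑ + ‖b‖ₑ) ^ 2 := by gcongr; exact enorm_add_le _ _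
  refine h.trans ?_
  have h2 : (‖a‖ + ‖b‖) ^ 2 ≤ 2 * ‖a‖ ^ 2 + 2 * ‖b‖ ^ 2 := by nlinarith [sq_nonneg (‖a‖ - ‖b‖)]
  have h3 := ENNReal.ofReal_le_ofReal h2
  rw [ENNReal.ofReal_add (by positivity) (by positivity), ENNReal.ofReal_mul (by norm_num),
    ENNReal.ofReal_mul (by norm_num), ENNReal.ofReal_pow (by positivity),
    ENNReal.ofReal_pow (by positivity), ENNReal.ofReal_pow (by positivity),
    ENNReal.ofReal_add (by positivity) (by positivity)] at h3
  simpa using h3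

lemma lintegral_enorm_sub_sq_le {f g h : X → F} (hf : AEStronglyMeasurable (f - g) μ) :
    ∫⁻ x, ‖f x - h x‖ₑ ^ 2 ∂μ ≤
      2 * ∫⁻ x, ‖f x - g x‖ₑ ^ 2 ∂μ + 2 * ∫⁻ x, ‖g x - h x‖ₑ ^ 2 ∂μ := by
  rw [← lintegral_const_mul' _ _ (by simp), ← lintegral_const_mul' _ _ (by simp),
    ← lintegral_add_left' (by exact (hf.enorm.pow_const 2).const_mul 2)]
  refine lintegral_mono fun x => ?_
  rw [← sub_add_sub_cancel (f x) (g x) (h x)]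
  exact enorm_add_sq_le _ _

end SquareIntegrals

/-! ### Duality with test functions and translations -/

section Translation

variable {E : Type*} [NormedAddCommGroup E] [NormedSpace ℝ E]

lemma IsTestFunction.mono {U V : Set E} {φ : E → ℝ} (h : IsTestFunction U φ) (hUV : U ⊆ V) :
    IsTestFunction V φ :=
  ⟨h.1, h.2.1, h.2.2.trans hUV⟩

lemma IsTestFunction.zero_of_notMem {U : Set E} {φ : E → ℝ} (h : IsTestFunction U φ) {x : E}
    (hx : x ∉ U) : φ x = 0 :=
  image_eq_zero_of_notMem_tsupport fun h' => hx (h.2.2 h')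

lemma IsTestFunction.fderiv_zero_of_notMem {U : Set E} {φ : E → ℝ} (h : IsTestFunction U φ) {x : E}
    (hx : x ∉ U) : fderiv ℝ φ x = 0 :=
  image_eq_zero_of_notMem_tsupport fun h' => hx (h.2.2 (tsupport_fderiv_subset ℝ h'))

lemma IsTestFunction.continuous_fderiv {U : Set E} {φ : E → ℝ} (h : IsTestFunction U φ) :
    Continuous (fderiv ℝ φ) :=
  h.1.continuous_fderiv (by simp)

lemma IsTestFunction.differentiable {U : Set E} {φ : E → ℝ} (h : IsTestFunction U φ) :
    Differentiable ℝ φ :=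
  h.1.differentiable (by simp)

lemma IsTestFunction.add {U : Set E} {φ ψ : E → ℝ} (h : IsTestFunction U φ)
    (h' : IsTestFunction U ψ) : IsTestFunction U (φ + ψ) :=
  ⟨h.1.add h'.1, h.2.1.add h'.2.1, (tsupport_add φ ψ).trans (union_subset h.2.2 h'.2.2)⟩

lemma IsTestFunction.const_smul {U : Set E} {φ : E → ℝ} (h : IsTestFunction U φ) (c : ℝ) :
    IsTestFunction U (c • φ) := by
  refine ⟨h.1.const_smul c, h.2.1.smul_left (f := fun _ => c), ?_⟩
  exact (tsupport_smul_subset_right (fun _ => c) φ).trans h.2.2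

lemma isTestFunction_zero (U : Set E) : IsTestFunction U (0 : E → ℝ) :=
  ⟨contDiff_const, HasCompactSupport.zero, by simp [tsupport]⟩

/-- The translate of a test function. -/
lemma IsTestFunction.translate {U V : Set E} {φ : E → ℝ} (h : IsTestFunction U φ) (a : E)
    (hV : ∀ x ∈ U, x + a ∈ V) : IsTestFunction V (fun x => φ (x - a)) := by
  refine ⟨h.1.comp (contDiff_id.sub contDiff_const), ?_, ?_⟩
  · exact h.2.1.comp_homeomorph (Homeomorph.subRight a)
  · intro x hx
    have : tsupport (φ ∘ (Homeomorph.subRight a)) = _ := tsupport_comp_eq_preimage φ (Homeomorph.subRight a)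
    have hx' : x ∈ tsupport (φ ∘ (Homeomorph.subRight a)) := hx
    rw [this] at hx'
    have := hV _ (h.2.2 hx')
    simpa using this

lemma IsTestFunction.memLp [MeasureSpace E] [BorelSpace E]
    [IsFiniteMeasureOnCompacts (volume : Measure E)] {U : Set E} {φ : E → ℝ}
    (h : IsTestFunction U φ) (p : ℝ≥0∞) : MemLp φ p volume :=
  h.1.continuous.memLp_of_hasCompactSupport h.2.1

variable [FiniteDimensional ℝ E] [MeasureSpace E] [BorelSpace E]

/-- An L² function orthogonal to all test functions is locally integrable with vanishing integrals
against them, hence zero almost everywhere; so the orthogonal complement of their span is trivial.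
-/
lemma dense_test_functions [IsFiniteMeasureOnCompacts (volume : Measure E)] {V : Set E}
    (hV : IsOpen V) : Dense {g : Lp ℝ 2 (volume.restrict V) |
      ∃ φ : E → ℝ, IsTestFunction V φ ∧ g =ᵐ[volume.restrict V] φ} := by
  let S : Submodule ℝ (Lp ℝ 2 (volume.restrict V)) :=
    { carrier := {g | ∃ φ : E → ℝ, IsTestFunction V φ ∧ g =ᵐ[volume.restrict V] φ}
      add_mem' := by
        rintro a b ⟨φ, hφ, ha⟩ ⟨ψ, hψ, hb⟩
        exact ⟨φ + ψ, hφ.add hψ, (Lp.coeFn_add a b).trans (ha.add hb)⟩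
      zero_mem' := ⟨0, isTestFunction_zero V, Lp.coeFn_zero _ _ _⟩
      smul_mem' := by
        rintro c a ⟨φ, hφ, ha⟩
        exact ⟨c • φ, hφ.const_smul c, (Lp.coeFn_smul c a).trans (ha.const_smul c)⟩ }
  suffices h : S.topologicalClosure = ⊤ from
    Submodule.dense_iff_topologicalClosure_eq_top.2 h
  rw [Submodule.topologicalClosure_eq_top_iff, Submodule.eq_bot_iff]
  intro g hg
  have hloc : LocallyIntegrableOn g V volume := by
    rw [locallyIntegrableOn_iff hV.isLocallyClosed]
    intro k hk hkc
    have h1 : MemLp g 2 (volume.restrict k) :=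
      (Lp.memLp g).mono_measure (Measure.restrict_mono_set _ hk)
    have : IsFiniteMeasure (volume.restrict k) := ⟨by simpa using hkc.measure_lt_top⟩
    exact h1.integrable (by norm_num)
  have h0 := hV.ae_eq_zero_of_integral_contDiff_smul_eq_zero hloc fun φ h1 h2 h3 => by
    have hφ : IsTestFunction V φ := ⟨h1, h2, h3⟩
    have hm : MemLp φ 2 (volume.restrict V) := (hφ.memLp 2).restrict V
    have h4 : hm.toLp φ ∈ S := ⟨φ, hφ, hm.coeFn_toLp⟩
    have h5 := hg _ h4
    rw [MeasureTheory.L2.inner_def] at h5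
    rw [← setIntegral_eq_integral_of_forall_compl_eq_zero (s := V) fun x hx => by
      simp [hφ.zero_of_notMem hx], ← h5]
    refine integral_congr_ae ?_
    filter_upwards [hm.coeFn_toLp] with x hx
    rw [hx]
    simp [mul_comm]
  refine Lp.ext ?_
  rw [← ae_restrict_iff' hV.measurableSet] at h0
  filter_upwards [h0, Lp.coeFn_zero ℝ 2 (volume.restrict V)] with x hx hx'
  rw [hx, hx', Pi.zero_apply]

/-- A function whose pairing with test functions is bounded by their `L²` norm is bounded in
`L²`. -/
lemma lintegral_sq_le_of_test [IsFiniteMeasureOnCompacts (volume : Measure E)] {V : Set E}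
    (hV : IsOpen V) {v : E → ℝ} (hv : MemLp v 2 (volume.restrict V)) {K : ℝ≥0∞}
    (h : ∀ φ : E → ℝ, IsTestFunction V φ →
      ‖∫ x in V, v x * φ x‖ₑ ^ 2 ≤ K * ∫⁻ x, ‖φ x‖ₑ ^ 2) :
    ∫⁻ x in V, ‖v x‖ₑ ^ 2 ≤ K := by
  rcases eq_or_ne K ⊤ with rfl | hK
  · exact le_top
  lift K to ℝ≥0 using hK
  let w := hv.toLp v
  -- The hypothesis is a closed condition on the test function, so it passes to all of L² by
  -- density. It is then applied to `w` itself and one factor `‖w‖ ^ 2` is cancelled.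
  have key : ∀ g : Lp ℝ 2 (volume.restrict V), (inner ℝ w g) ^ 2 ≤ (K : ℝ) * ‖g‖ ^ 2 := by
    intro g
    have hcl : IsClosed {g : Lp ℝ 2 (volume.restrict V) |
        (inner ℝ w g) ^ 2 ≤ (K : ℝ) * ‖g‖ ^ 2} :=
      isClosed_le (by fun_prop) (by fun_prop)
    refine hcl.closure_subset_iff.2 ?_ (dense_test_functions hV g)
    rintro g ⟨φ, hφ, hg⟩
    have h1 := h φ hφ
    have h2 : inner ℝ w g = ∫ x in V, v x * φ x := by
      rw [MeasureTheory.L2.inner_def]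
      refine integral_congr_ae ?_
      filter_upwards [hg, hv.coeFn_toLp] with x hx hx'
      rw [hx, hx']
      simp [mul_comm]
    have h3 : ENNReal.ofReal (‖g‖ ^ 2) = ∫⁻ x, ‖φ x‖ₑ ^ 2 := by
      rw [← setLIntegral_eq_of_support_subset (s := V) (by
        intro x hx
        by_contra hx'
        simp [hφ.zero_of_notMem hx'] at hx), ENNReal.ofReal_pow (norm_nonneg _),
        ofReal_norm, Lp.enorm_def, eLpNorm_two_sq]
      refine lintegral_congr_ae ?_
      filter_upwards [hg] with x hx
      rw [hx]
    rw [← h2, ← h3, ← ofReal_norm, ← ENNReal.ofReal_pow (norm_nonneg _),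
      ← ENNReal.ofReal_coe_nnreal, ← ENNReal.ofReal_mul K.coe_nonneg,
      ENNReal.ofReal_le_ofReal_iff (by positivity)] at h1
    simpa using h1
  have h1 := key w
  rw [real_inner_self_eq_norm_sq] at h1
  have h2 : ‖w‖ ^ 2 ≤ K := by
    rcases eq_or_ne ‖w‖ 0 with h0 | h0
    · rw [h0]; simp
    · have : 0 < ‖w‖ ^ 2 := by positivity
      rw [sq (‖w‖ ^ 2)] at h1
      exact le_of_mul_le_mul_right h1 this
  have h3 : ENNReal.ofReal (‖w‖ ^ 2) = ∫⁻ x in V, ‖v x‖ₑ ^ 2 := by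
    rw [ENNReal.ofReal_pow (norm_nonneg _), ofReal_norm, Lp.enorm_def, eLpNorm_two_sq]
    refine lintegral_congr_ae ?_
    filter_upwards [hv.coeFn_toLp] with x hx
    rw [hx]
  rw [← h3, ← ENNReal.ofReal_coe_nnreal]
  exact ENNReal.ofReal_le_ofReal h2

/-- A bound on the pairing of `u` with directional derivatives of test functions bounds the
difference of `u` and its translate. -/
lemma lintegral_translate_sub_sq_le [(volume : Measure E).IsAddHaarMeasure] {Q : Set E}
    (hQ : IsOpen Q) (hc : Convex ℝ Q) (hfin : volume Q ≠ ⊤) {u : E → ℝ}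
    (hu : MemLp u 2 (volume.restrict Q)) (a : E) {K : ℝ≥0∞}
    (h : ∀ φ : E → ℝ, IsTestFunction Q φ →
      ‖∫ x in Q, u x * fderiv ℝ φ x a‖ₑ ^ 2 ≤ K * ∫⁻ x, ‖φ x‖ₑ ^ 2) :
    ∫⁻ x in Q ∩ {x | x + a ∈ Q}, ‖u (x + a) - u x‖ₑ ^ 2 ≤ K := by
  rcases eq_or_ne K ⊤ with rfl | hK
  · exact le_top
  have hVo : IsOpen (Q ∩ {x | x + a ∈ Q}) := hQ.inter (hQ.preimage (by fun_prop))
  have hmp : MeasurePreserving (fun x : E => x + a) (volume.restrict {x | x + a ∈ Q})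
      (volume.restrict Q) :=
    (measurePreserving_add_right volume a).restrict_preimage hQ.measurableSet
  have hua : MemLp (fun x => u (x + a)) 2 (volume.restrict (Q ∩ {x | x + a ∈ Q})) :=
    (hu.comp_measurePreserving hmp).mono_measure (Measure.restrict_mono_set _ inter_subset_right)
  have hu' : MemLp u 2 (volume.restrict (Q ∩ {x | x + a ∈ Q})) :=
    hu.mono_measure (Measure.restrict_mono_set _ inter_subset_left)
  refine lintegral_sq_le_of_test hVo (hua.sub hu') fun φ hφ => ?_
  have : IsFiniteMeasure (volume.restrict Q) := ⟨by simpa using hfin.lt_top⟩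
  have hui : Integrable u (volume.restrict Q) := hu.integrable (by norm_num)
  -- If `x` and `x + a` lie in `Q`, convexity puts `x + s • a` in `Q`, so `h` applies to every
  -- intermediate translate of `φ`.
  have hφ1 : ∀ s ∈ Icc (0 : ℝ) 1, IsTestFunction Q (fun x => φ (x - s • a)) := by
    intro s hs
    refine hφ.translate _ fun x hx => ?_
    have := hc hx.1 hx.2 (sub_nonneg.2 hs.2) hs.1 (by ring)
    convert this using 1
    module
  obtain ⟨M, hM⟩ : ∃ M, ∀ x, ‖fderiv ℝ φ x‖ ≤ M :=
    hφ.continuous_fderiv.bounded_above_of_compact_support (hφ.2.1.fderiv ℝ)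
  obtain ⟨M', hM'⟩ : ∃ M, ∀ x, ‖φ x‖ ≤ M :=
    hφ.1.continuous.bounded_above_of_compact_support hφ.2.1
  -- The translation is carried by the smooth `φ`, since `u` itself cannot be differentiated.
  have hder : ∀ s : ℝ, HasDerivAt (fun s : ℝ => ∫ x in Q, u x * φ (x - s • a))
      (∫ x in Q, u x * (-(fderiv ℝ φ (x - s • a) a))) s := by
    intro s
    refine (hasDerivAt_integral_of_dominated_loc_of_deriv_le (s := univ)
      (F := fun (s : ℝ) x => u x * φ (x - s • a))
      (F' := fun (s : ℝ) x => u x * (-(fderiv ℝ φ (x - s • a) a)))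
      (bound := fun x => ‖u x‖ * (M * ‖a‖)) Filter.univ_mem ?_ ?_ ?_ ?_ ?_ ?_).2
    · refine Filter.Eventually.of_forall fun s => hui.1.mul ?_
      exact (hφ.1.continuous.comp (by fun_prop)).aestronglyMeasurable
    · exact hui.mul_bdd (c := M') (hφ.1.continuous.comp (by fun_prop)).aestronglyMeasurable
        (Filter.Eventually.of_forall fun x => hM' _)
    · refine hui.1.mul ?_
      have : Continuous fun x => fderiv ℝ φ (x - s • a) :=
        hφ.continuous_fderiv.comp (by fun_prop)
      exact (this.clm_apply continuous_const).neg.aestronglyMeasurable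
    · refine Filter.Eventually.of_forall fun x s _ => ?_
      rw [norm_mul, norm_neg]
      gcongr
      exact (ContinuousLinearMap.le_opNorm _ _).trans (by gcongr; exact hM _)
    · exact hui.norm.mul_const _
    · refine Filter.Eventually.of_forall fun x s _ => ?_
      have h1 : HasDerivAt (fun s : ℝ => x - s • a) (-a) s := by
        simpa using ((hasDerivAt_id s).smul_const a).const_sub x
      have h2 := (hφ.differentiable (x - s • a)).hasFDerivAt.comp_hasDerivAt s h1
      have h3 := h2.const_mul (u x)
      simpa using h3
  -- Translation does not change the L² norm of `φ`, so the bound is uniform in `s` and the mean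
  -- value inequality loses nothing.
  have hbd : ∀ s ∈ Icc (0 : ℝ) 1, ‖∫ x in Q, u x * (-(fderiv ℝ φ (x - s • a) a))‖ ≤
      Real.sqrt (K * ∫⁻ x, ‖φ x‖ₑ ^ 2).toReal := by
    intro s hs
    have h1 := h _ (hφ1 s hs)
    have h2 : ∀ x, fderiv ℝ (fun x => φ (x - s • a)) x = fderiv ℝ φ (x - s • a) := fun x => by
      rw [fderiv_comp_sub]
    simp_rw [h2] at h1
    rw [lintegral_sub_right_eq_self (fun x => ‖φ x‖ₑ ^ 2) (s • a)] at h1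
    simp_rw [mul_neg]
    rw [integral_neg, norm_neg]
    refine Real.le_sqrt_of_sq_le ?_
    have h3 := ENNReal.toReal_mono (ENNReal.mul_ne_top hK
      (lintegral_enorm_sq_ne_top (hφ.memLp 2))) h1
    simpa using h3
  have hmv := norm_image_sub_le_of_norm_deriv_le_segment_01'
    (fun s _ => (hder s).hasDerivWithinAt) (fun s hs => hbd s (Ico_subset_Icc_self hs))
  have hid : ∫ x in Q ∩ {x | x + a ∈ Q}, (u (x + a) - u x) * φ x =
      (∫ x in Q, u x * φ (x - (1 : ℝ) • a)) - ∫ x in Q, u x * φ (x - (0 : ℝ) • a) := by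
    have e1 : ∫ x in Q, u x * φ (x - (1 : ℝ) • a) =
        ∫ x in Q ∩ {x | x + a ∈ Q}, u (x + a) * φ x := by
      rw [← hmp.integral_comp (measurableEmbedding_addRight a)]
      simp only [one_smul, add_sub_cancel_right]
      refine (setIntegral_eq_of_subset_of_forall_sdiff_eq_zero
        (hQ.preimage (by fun_prop : Continuous fun x : E => x + a)).measurableSet
        inter_subset_right fun x hx => ?_)
      rw [hφ.zero_of_notMem hx.2, mul_zero]
    have e2 : ∫ x in Q, u x * φ (x - (0 : ℝ) • a) = ∫ x in Q ∩ {x | x + a ∈ Q}, u x * φ x := by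
      simp only [zero_smul, sub_zero]
      refine (setIntegral_eq_of_subset_of_forall_sdiff_eq_zero hQ.measurableSet
        inter_subset_left fun x hx => ?_)
      rw [hφ.zero_of_notMem hx.2, mul_zero]
    have hφV : MemLp φ 2 (volume.restrict (Q ∩ {x | x + a ∈ Q})) := (hφ.memLp 2).restrict _
    simp_rw [sub_mul]
    rw [e1, e2]
    exact integral_sub (hua.integrable_mul hφV) (hu'.integrable_mul hφV)
  change ‖∫ x in Q ∩ {x | x + a ∈ Q}, (u (x + a) - u x) * φ x‖ₑ ^ 2 ≤ _
  rw [hid, ← ofReal_norm, ← ENNReal.ofReal_pow (norm_nonneg _)]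
  refine ENNReal.ofReal_le_of_le_toReal ?_
  calc _ ≤ Real.sqrt (K * ∫⁻ x, ‖φ x‖ₑ ^ 2).toReal ^ 2 := by gcongr
    _ = _ := Real.sq_sqrt ENNReal.toReal_nonneg

/-- A Poincaré inequality on a convex set, in terms of differences. -/
lemma lintegral_lintegral_sub_sq_le [(volume : Measure E).IsAddHaarMeasure] {Q B : Set E}
    (hQ : IsOpen Q) (hc : Convex ℝ Q) (hfin : volume Q ≠ ⊤) (hB : MeasurableSet B)
    (hQB : ∀ x ∈ Q, ∀ y ∈ Q, y - x ∈ B) {u : E → ℝ}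
    (hu : MemLp u 2 (volume.restrict Q)) {K : ℝ≥0∞}
    (h : ∀ a ∈ B, ∀ φ : E → ℝ, IsTestFunction Q φ →
      ‖∫ x in Q, u x * fderiv ℝ φ x a‖ₑ ^ 2 ≤ K * ∫⁻ x, ‖φ x‖ₑ ^ 2) :
    ∫⁻ x in Q, ∫⁻ y in Q, ‖u x - u y‖ₑ ^ 2 ≤ volume B * K := by
  -- A genuinely measurable representative is needed for the joint measurability behind Tonelli's
  -- theorem below.
  obtain ⟨g, hg, hgu⟩ := hu.1
  have e1 : ∫⁻ x in Q, ∫⁻ y in Q, ‖u x - u y‖ₑ ^ 2 = ∫⁻ x in Q, ∫⁻ y in Q, ‖g x - g y‖ₑ ^ 2 := by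
    refine lintegral_congr_ae ?_
    filter_upwards [hgu] with x hx
    refine lintegral_congr_ae ?_
    filter_upwards [hgu] with y hy
    rw [hx, hy]
  have hind : ∀ (P : E → ℝ≥0∞), ∫⁻ x in Q, P x = ∫⁻ x, Q.indicator 1 x * P x := by
    intro P
    rw [← lintegral_indicator hQ.measurableSet]
    refine lintegral_congr fun x => ?_
    by_cases hx : x ∈ Q <;> simp [hx]
  have hm1 : Measurable (Q.indicator (1 : E → ℝ≥0∞)) :=
    measurable_const.indicator hQ.measurableSet
  have hgm := hg.measurable
  calc ∫⁻ x in Q, ∫⁻ y in Q, ‖u x - u y‖ₑ ^ 2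
      = ∫⁻ x, ∫⁻ y, Q.indicator 1 x * (Q.indicator 1 y * ‖g x - g y‖ₑ ^ 2) := by
        rw [e1, hind]
        refine lintegral_congr fun x => ?_
        rw [hind, lintegral_const_mul' _ _ (by by_cases hx : x ∈ Q <;> simp [hx])]
    -- Substitute `y = x + a`; after the swap, each fixed `a` is a translation estimate, and only `a
    -- ∈ B` contributes.
    _ = ∫⁻ x, ∫⁻ a, Q.indicator 1 x * (Q.indicator 1 (x + a) * ‖g x - g (x + a)‖ₑ ^ 2) := by
        refine lintegral_congr fun x => ?_
        exact (lintegral_add_left_eq_self (fun y => Q.indicator 1 x *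
          (Q.indicator 1 y * ‖g x - g y‖ₑ ^ 2)) x).symm
    _ = ∫⁻ a, ∫⁻ x, Q.indicator 1 x * (Q.indicator 1 (x + a) * ‖g x - g (x + a)‖ₑ ^ 2) := by
        refine lintegral_lintegral_swap (Measurable.aemeasurable ?_)
        refine (hm1.comp measurable_fst).mul ((hm1.comp (by fun_prop)).mul ?_)
        exact (((hgm.comp measurable_fst).sub (hgm.comp (by fun_prop))).enorm).pow_const 2
    _ ≤ ∫⁻ a, B.indicator (fun _ => K) a := by
        refine lintegral_mono fun a => ?_
        by_cases ha : a ∈ B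
        · rw [indicator_of_mem ha]
          refine le_trans (le_of_eq ?_) (lintegral_translate_sub_sq_le hQ hc hfin hu a (h a ha))
          have hVo : MeasurableSet (Q ∩ {x | x + a ∈ Q}) :=
            (hQ.inter (hQ.preimage (by fun_prop))).measurableSet
          have hmp : MeasurePreserving (fun x : E => x + a) (volume.restrict {x | x + a ∈ Q})
              (volume.restrict Q) :=
            (measurePreserving_add_right volume a).restrict_preimage hQ.measurableSet
          have a1 : ∀ᵐ x ∂(volume.restrict (Q ∩ {x | x + a ∈ Q})), u x = g x :=
            ae_restrict_of_ae_restrict_of_subset inter_subset_left hgu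
          have a2 : ∀ᵐ x ∂(volume.restrict (Q ∩ {x | x + a ∈ Q})), u (x + a) = g (x + a) :=
            ae_restrict_of_ae_restrict_of_subset inter_subset_right
              (hmp.quasiMeasurePreserving.ae hgu)
          have a3 : ∫⁻ x in Q ∩ {x | x + a ∈ Q}, ‖u (x + a) - u x‖ₑ ^ 2 =
              ∫⁻ x in Q ∩ {x | x + a ∈ Q}, ‖g (x + a) - g x‖ₑ ^ 2 := by
            refine lintegral_congr_ae ?_
            filter_upwards [a1, a2] with x h1 h2
            rw [h1, h2]
          rw [a3, ← lintegral_indicator hVo]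
          refine lintegral_congr fun x => ?_
          by_cases h1 : x ∈ Q <;> by_cases h2 : x + a ∈ Q <;>
            simp [indicator, h1, h2, ← enorm_neg (g x - g (x + a))]
        · rw [indicator_of_notMem ha, nonpos_iff_eq_zero]
          refine lintegral_eq_zero_of_ae_eq_zero (Filter.Eventually.of_forall fun x => ?_)
          by_cases h1 : x ∈ Q
          · by_cases h2 : x + a ∈ Q
            · exact absurd (by simpa using hQB x h1 _ h2) ha
            · simp [h2]
          · simp [h1]
    _ = volume B * K := by rw [lintegral_indicator hB]; simp [mul_comm]

/-- A Poincaré inequality on a convex set, for the distance to a weighted average. -/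
lemma lintegral_sub_average_sq_le [(volume : Measure E).IsAddHaarMeasure] {Q B : Set E}
    (hQ : IsOpen Q) (hc : Convex ℝ Q) (hfin : volume Q ≠ ⊤) (hB : MeasurableSet B)
    (hQB : ∀ x ∈ Q, ∀ y ∈ Q, y - x ∈ B) {u : E → ℝ}
    (hu : MemLp u 2 (volume.restrict Q)) {K : ℝ≥0∞}
    (h : ∀ a ∈ B, ∀ φ : E → ℝ, IsTestFunction Q φ →
      ‖∫ x in Q, u x * fderiv ℝ φ x a‖ₑ ^ 2 ≤ K * ∫⁻ x, ‖φ x‖ₑ ^ 2)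
    {ψ : E → ℝ} (hψ : MemLp ψ 2 (volume.restrict Q)) (hψ1 : ∫ x in Q, ψ x = 1) :
    ∫⁻ x in Q, ‖u x - ∫ y in Q, u y * ψ y‖ₑ ^ 2 ≤
      (∫⁻ y in Q, ‖ψ y‖ₑ ^ 2) * (volume B * K) := by
  have : IsFiniteMeasure (volume.restrict Q) := ⟨by simpa using hfin.lt_top⟩
  refine le_trans ?_ (mul_le_mul_right (lintegral_lintegral_sub_sq_le hQ hc hfin hB hQB hu h) _)
  rw [← lintegral_const_mul' _ _ (lintegral_enorm_sq_ne_top hψ)]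
  refine lintegral_mono fun x => ?_
  -- Because `ψ` has integral one, the deviation is a `ψ`-weighted integral of differences, ready
  -- for Cauchy–Schwarz.
  have e : u x - ∫ y in Q, u y * ψ y = ∫ y in Q, (u x - u y) * ψ y := by
    simp_rw [sub_mul]
    have hint : Integrable (fun y => u y * ψ y) (volume.restrict Q) := hu.integrable_mul hψ
    rw [integral_sub ((hψ.integrable (by norm_num)).const_mul _) hint,
      integral_const_mul, hψ1, mul_one]
  rw [e, mul_comm]
  exact enorm_integral_mul_sq_le (aestronglyMeasurable_const.sub hu.1) hψ.1

end Translation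

/-! ### Tilings -/

/-- The sets `Q i`, `i ∈ S`, tile `U` up to a null set. -/
structure IsTiling {X ι : Type*} [MeasureSpace X] (S : Finset ι) (Q : ι → Set X) (U : Set X) :
    Prop where
  measurableSet : ∀ i ∈ S, MeasurableSet (Q i)
  subset : ∀ i ∈ S, Q i ⊆ U
  pairwiseDisjoint : (S : Set ι).PairwiseDisjoint Q
  volume_ne_top : volume U ≠ ⊤
  sum_volume : ∑ i ∈ S, volume (Q i) = volume U

namespace IsTiling

variable {X ι : Type*} [MeasureSpace X] {S : Finset ι} {Q : ι → Set X} {U : Set X}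

/-- Disjoint tiles whose volumes add up to the finite volume of `U` can only miss a null set. -/
lemma ae_eq (h : IsTiling S Q U) : (⋃ i ∈ S, Q i) =ᵐ[volume] U := by
  refine ae_eq_of_subset_of_measure_ge (iUnion₂_subset h.subset) ?_
    (Finset.measurableSet_biUnion _ h.measurableSet).nullMeasurableSet h.volume_ne_top
  rw [measure_biUnion_finset h.pairwiseDisjoint h.measurableSet, h.sum_volume]

lemma lintegral_eq (h : IsTiling S Q U) (f : X → ℝ≥0∞) :
    ∫⁻ x in U, f x = ∑ i ∈ S, ∫⁻ x in Q i, f x := by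
  rw [← setLIntegral_congr h.ae_eq, lintegral_biUnion_finset h.pairwiseDisjoint h.measurableSet]

lemma integral_eq (h : IsTiling S Q U) {f : X → ℝ} (hf : IntegrableOn f U) :
    ∫ x in U, f x = ∑ i ∈ S, ∫ x in Q i, f x := by
  rw [← setIntegral_congr_set h.ae_eq,
    integral_biUnion_finset S h.measurableSet h.pairwiseDisjoint
      fun i hi => hf.mono_set (h.subset i hi)]

lemma prod {Y κ : Type*} [MeasureSpace Y] [SFinite (volume : Measure Y)] {T : Finset κ}
    {P : κ → Set Y} {V : Set Y} (h : IsTiling S Q U) (h' : IsTiling T P V) :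
    IsTiling (S ×ˢ T) (fun p => Q p.1 ×ˢ P p.2) (U ×ˢ V) where
  measurableSet p hp := (h.measurableSet _ (Finset.mem_product.1 hp).1).prod
    (h'.measurableSet _ (Finset.mem_product.1 hp).2)
  subset p hp := prod_mono (h.subset _ (Finset.mem_product.1 hp).1)
    (h'.subset _ (Finset.mem_product.1 hp).2)
  pairwiseDisjoint := by
    intro p hp q hq hpq
    rw [Finset.mem_coe, Finset.mem_product] at hp hq
    change Disjoint _ _
    rw [disjoint_prod]
    by_cases h1 : p.1 = q.1
    · exact Or.inr (h'.pairwiseDisjoint hp.2 hq.2 fun h2 => hpq (Prod.ext h1 h2))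
    · exact Or.inl (h.pairwiseDisjoint hp.1 hq.1 h1)
  volume_ne_top := by
    rw [Measure.volume_eq_prod, Measure.prod_prod]
    exact ENNReal.mul_ne_top h.volume_ne_top h'.volume_ne_top
  sum_volume := by
    simp_rw [Measure.volume_eq_prod, Measure.prod_prod]
    rw [Finset.sum_product, ← h.sum_volume, ← h'.sum_volume, Finset.sum_mul_sum]

end IsTiling

/-! ### The triadic grid -/

/-- The integers `j` with `|j| < 3 ^ k / 2`. -/
def centeredInts (k : ℕ) : Finset ℤ := Finset.Icc (-(3 ^ k / 2)) (3 ^ k / 2)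

/-- Oddness makes the centred range of indices symmetric with exactly `3 ^ k` elements, with no
lattice point on the boundary. -/
lemma three_pow_odd (k : ℕ) : ∃ N : ℤ, (3 : ℤ) ^ k = 2 * N + 1 ∧ 0 ≤ N := by
  obtain ⟨N, hN⟩ := (by decide : Odd (3 : ℤ)).pow (n := k)
  exact ⟨N, hN, by have : (0 : ℤ) < 3 ^ k := by positivity
                   omega⟩

lemma card_centeredInts (k : ℕ) : (centeredInts k).card = 3 ^ k := by
  obtain ⟨N, hN, h0⟩ := three_pow_odd k
  zify
  rw [centeredInts, Int.card_Icc_of_le _ _ (by omega), hN]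
  omega

lemma mem_centeredInts {k : ℕ} {j : ℤ} :
    j ∈ centeredInts k ↔ -(3 : ℤ) ^ k < 2 * j ∧ 2 * j < 3 ^ k := by
  obtain ⟨N, hN, h0⟩ := three_pow_odd k
  rw [centeredInts, Finset.mem_Icc, hN]
  omega

/-- By parity the strict inequalities improve by one, which is the room needed for the whole cell,
and not only its centre, to fit in the large interval. -/
lemma mem_centeredInts' {k : ℕ} {j : ℤ} (hj : j ∈ centeredInts k) :
    -(3 : ℤ) ^ k + 1 ≤ 2 * j ∧ 2 * j + 1 ≤ 3 ^ k := by
  rw [mem_centeredInts] at hj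
  omega

/-- The interval of length `r` centred at `r j`. -/
def gridInterval (r : ℝ) (j : ℤ) : Set ℝ := Ioo (r * j - r / 2) (r * j + r / 2)

/-- The cube of side length `r` centred at `r k`. -/
def gridCube (d : ℕ) (r : ℝ) (k : Fin d → ℤ) : Set (Space d) := {x | ∀ i, x i ∈ gridInterval r (k i)}

lemma timeInterval_eq (n : ℕ) : timeInterval n = gridInterval (3 ^ (2 * n)) 0 := by
  simp [timeInterval, gridInterval]

lemma spaceCube_eq (d n : ℕ) : spaceCube d n = gridCube d (3 ^ n) 0 := by
  simp [spaceCube, gridCube, gridInterval]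

/-- Rounding recovers the index of the cell. This yields disjointness of the cells and, later, a
measurable index function. -/
lemma round_of_mem_gridInterval {r : ℝ} (hr : 0 < r) {j : ℤ} {x : ℝ} (hx : x ∈ gridInterval r j) :
    round (x / r) = j := by
  rw [round_eq, Int.floor_eq_iff, ← sub_le_iff_le_add, le_div_iff₀ hr, ← lt_sub_iff_add_lt,
    div_lt_iff₀ hr]
  constructor <;> nlinarith [hx.1, hx.2]

lemma gridInterval_subset {r : ℝ} (hr : 0 < r) {k : ℕ} {j : ℤ} (hj : j ∈ centeredInts k) :
    gridInterval r j ⊆ gridInterval (r * 3 ^ k) 0 := by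
  rintro x ⟨h1, h2⟩
  obtain ⟨h3, h4⟩ := mem_centeredInts' hj
  have h3' : -(3 : ℝ) ^ k + 1 ≤ 2 * j := by exact_mod_cast h3
  have h4' : 2 * (j : ℝ) + 1 ≤ 3 ^ k := by exact_mod_cast h4
  constructor <;> push_cast <;> nlinarith

lemma mem_gridInterval_zero_iff {r : ℝ} (hr : 0 < r) {k : ℕ} {j : ℤ} :
    r * j ∈ gridInterval (r * 3 ^ k) 0 ↔ j ∈ centeredInts k := by
  rw [mem_centeredInts, gridInterval, mem_Ioo]
  have e1 : -(3 : ℤ) ^ k < 2 * j ↔ -(3 : ℝ) ^ k < 2 * j := by exact_mod_cast Iff.rfl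
  have e2 : 2 * j < (3 : ℤ) ^ k ↔ 2 * (j : ℝ) < 3 ^ k := by exact_mod_cast Iff.rfl
  rw [e1, e2]
  push_cast
  constructor <;> rintro ⟨h1, h2⟩ <;> constructor <;> nlinarith

lemma isOpen_gridInterval (r : ℝ) (j : ℤ) : IsOpen (gridInterval r j) := isOpen_Ioo

lemma volume_gridInterval (r : ℝ) (j : ℤ) : volume (gridInterval r j) = ENNReal.ofReal r := by
  rw [gridInterval, Real.volume_Ioo]
  congr 1
  ring

lemma gridCube_eq_preimage (d : ℕ) (r : ℝ) (k : Fin d → ℤ) :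
    gridCube d r k = WithLp.ofLp ⁻¹' (univ.pi fun i => gridInterval r (k i)) := by
  ext x
  simp [gridCube]

lemma isOpen_gridCube (d : ℕ) (r : ℝ) (k : Fin d → ℤ) : IsOpen (gridCube d r k) := by
  rw [gridCube_eq_preimage]
  exact (isOpen_set_pi finite_univ fun i _ => isOpen_gridInterval _ _).preimage
    (PiLp.continuous_ofLp 2 _)

lemma convex_gridCube (d : ℕ) (r : ℝ) (k : Fin d → ℤ) : Convex ℝ (gridCube d r k) := by
  intro x hx y hy a b ha hb hab i
  exact convex_Ioo _ _ (hx i) (hy i) ha hb hab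

lemma volume_gridCube (d : ℕ) {r : ℝ} (hr : 0 ≤ r) (k : Fin d → ℤ) :
    volume (gridCube d r k) = ENNReal.ofReal (r ^ d) := by
  rw [gridCube_eq_preimage, (PiLp.volume_preserving_ofLp (Fin d)).measure_preimage
    (MeasurableSet.univ_pi fun i => (isOpen_gridInterval _ _).measurableSet).nullMeasurableSet,
    volume_pi_pi]
  simp [volume_gridInterval, ENNReal.ofReal_pow hr]

lemma isTiling_gridInterval {r : ℝ} (hr : 0 < r) (k : ℕ) :
    IsTiling (centeredInts k) (gridInterval r) (gridInterval (r * 3 ^ k) 0) where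
  measurableSet _ _ := (isOpen_gridInterval _ _).measurableSet
  subset _ hj := gridInterval_subset hr hj
  pairwiseDisjoint i _ j _ hij := disjoint_left.2 fun x hx hx' =>
    hij ((round_of_mem_gridInterval hr hx).symm.trans (round_of_mem_gridInterval hr hx'))
  volume_ne_top := by simp [volume_gridInterval]
  sum_volume := by
    simp only [volume_gridInterval, Finset.sum_const, card_centeredInts, nsmul_eq_mul]
    rw [mul_comm r, ENNReal.ofReal_mul (by positivity), ENNReal.ofReal_pow (by norm_num)]
    simp

lemma isTiling_gridCube (d : ℕ) {r : ℝ} (hr : 0 < r) (k : ℕ) :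
    IsTiling (Fintype.piFinset fun _ : Fin d => centeredInts k) (gridCube d r)
      (gridCube d (r * 3 ^ k) 0) where
  measurableSet _ _ := (isOpen_gridCube _ _ _).measurableSet
  subset j hj x hx i := gridInterval_subset hr (Fintype.mem_piFinset.1 hj i) (hx i)
  pairwiseDisjoint i _ j _ hij := disjoint_left.2 fun x hx hx' =>
    hij (funext fun l => (round_of_mem_gridInterval hr (hx l)).symm.trans
      (round_of_mem_gridInterval hr (hx' l)))
  volume_ne_top := by rw [volume_gridCube d (by positivity)]; simp
  sum_volume := by
    simp_rw [volume_gridCube d hr.le]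
    rw [volume_gridCube d (by positivity)]
    simp only [Finset.sum_const, Fintype.card_piFinset, card_centeredInts, nsmul_eq_mul,
      Finset.prod_const, Finset.card_univ, Fintype.card_fin]
    rw [mul_comm r, mul_pow, ENNReal.ofReal_mul (by positivity), ENNReal.ofReal_pow (by positivity),
      ENNReal.ofReal_pow (by norm_num)]
    simp

/-- The index set of the cells of scale `m` in the cylinder of scale `n`. -/
def cellIndices (d m n : ℕ) : Finset (ℤ × (Fin d → ℤ)) :=
  centeredInts (2 * (n - m)) ×ˢ Fintype.piFinset fun _ : Fin d => centeredInts (n - m)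

/-- The cell of scale `m` with a given index. -/
def parCell (d m : ℕ) (p : ℤ × (Fin d → ℤ)) : Set (SpaceTime d) :=
  gridInterval (3 ^ (2 * m)) p.1 ×ˢ gridCube d (3 ^ m) p.2

lemma three_pow_mul {m n : ℕ} (h : m ≤ n) : (3 : ℝ) ^ m * 3 ^ (n - m) = 3 ^ n := by
  rw [← pow_add]; congr 1; omega

lemma three_pow_two_mul {m n : ℕ} (h : m ≤ n) :
    (3 : ℝ) ^ (2 * m) * 3 ^ (2 * (n - m)) = 3 ^ (2 * n) := by
  rw [← pow_add]; congr 1; omega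

lemma isTiling_timeInterval {m n : ℕ} (h : m ≤ n) :
    IsTiling (centeredInts (2 * (n - m))) (gridInterval (3 ^ (2 * m))) (timeInterval n) := by
  rw [timeInterval_eq, ← three_pow_two_mul h]
  exact isTiling_gridInterval (by positivity) _

lemma isTiling_spaceCube (d : ℕ) {m n : ℕ} (h : m ≤ n) :
    IsTiling (Fintype.piFinset fun _ : Fin d => centeredInts (n - m)) (gridCube d (3 ^ m))
      (spaceCube d n) := by
  rw [spaceCube_eq, ← three_pow_mul h]
  exact isTiling_gridCube d (by positivity) _

lemma isTiling_parCyl (d : ℕ) {m n : ℕ} (h : m ≤ n) :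
    IsTiling (cellIndices d m n) (parCell d m) (parCyl d n) :=
  (isTiling_timeInterval h).prod (isTiling_spaceCube d h)

lemma volume_timeInterval (n : ℕ) : volume (timeInterval n) = ENNReal.ofReal (3 ^ (2 * n)) := by
  rw [timeInterval_eq, volume_gridInterval]

lemma volume_spaceCube (d n : ℕ) : volume (spaceCube d n) = ENNReal.ofReal ((3 ^ n) ^ d) := by
  rw [spaceCube_eq, volume_gridCube d (by positivity)]

lemma volume_parCyl (d n : ℕ) :
    volume (parCyl d n) = volume (timeInterval n) * volume (spaceCube d n) := by
  rw [parCyl, Measure.volume_eq_prod, Measure.prod_prod]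

lemma volume_parCell (d m : ℕ) (p : ℤ × (Fin d → ℤ)) :
    volume (parCell d m p) = volume (parCyl d m) := by
  rw [volume_parCyl, parCell, Measure.volume_eq_prod, Measure.prod_prod, volume_gridInterval,
    volume_gridCube d (by positivity), volume_timeInterval, volume_spaceCube]

lemma measurableSet_parCell (d m : ℕ) (p : ℤ × (Fin d → ℤ)) : MeasurableSet (parCell d m p) :=
  (isOpen_gridInterval _ _).measurableSet.prod (isOpen_gridCube _ _ _).measurableSet

lemma isOpen_spaceCube (d n : ℕ) : IsOpen (spaceCube d n) := by
  rw [spaceCube_eq]; exact isOpen_gridCube _ _ _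

lemma isOpen_timeInterval (n : ℕ) : IsOpen (timeInterval n) := isOpen_Ioo

lemma volume_parCyl_ne_zero (d n : ℕ) : volume (parCyl d n) ≠ 0 := by
  rw [volume_parCyl, volume_timeInterval, volume_spaceCube, ← ENNReal.ofReal_mul (by positivity)]
  simp only [ne_eq, ENNReal.ofReal_eq_zero, not_le]
  positivity

lemma volume_parCyl_ne_top (d n : ℕ) : volume (parCyl d n) ≠ ⊤ := by
  rw [volume_parCyl, volume_timeInterval, volume_spaceCube, ← ENNReal.ofReal_mul (by positivity)]
  exact ENNReal.ofReal_ne_top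

/-- The centre of a cell. -/
def cellCentre (d m : ℕ) (p : ℤ × (Fin d → ℤ)) : SpaceTime d :=
  (3 ^ (2 * m) * p.1, WithLp.toLp 2 fun i => 3 ^ m * (p.2 i : ℝ))

lemma cellCentre_injective (d m : ℕ) : Function.Injective (cellCentre d m) := by
  rintro ⟨a, b⟩ ⟨a', b'⟩ h
  obtain ⟨h1, h2⟩ := Prod.ext_iff.1 h
  have h3 : (a : ℝ) = a' := mul_left_cancel₀ (by positivity) h1
  refine Prod.ext (by exact_mod_cast h3) (funext fun i => ?_)
  have h4 := congrArg (fun v : Space d => v i) h2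
  have h5 : (b i : ℝ) = b' i := mul_left_cancel₀ (by positivity) h4
  exact_mod_cast h5

/-- Together with `shift_parCyl`, this turns sums over lattice points into sums over the tiles of
the cylinder. -/
lemma toFinset_latticePoints (d : ℕ) {m n : ℕ} (h : m ≤ n) :
    (latticePoints_finite d m n).toFinset = (cellIndices d m n).image (cellCentre d m) := by
  ext z
  rw [Finite.mem_toFinset, Finset.mem_image]
  have ht : ∀ j : ℤ, (3 : ℝ) ^ (2 * m) * j ∈ timeInterval n ↔ j ∈ centeredInts (2 * (n - m)) := by
    intro j
    rw [timeInterval_eq, ← three_pow_two_mul h]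
    exact mem_gridInterval_zero_iff (by positivity)
  have hs : ∀ j : ℤ, (3 : ℝ) ^ m * j ∈ gridInterval (3 ^ n) 0 ↔ j ∈ centeredInts (n - m) := by
    intro j
    rw [← three_pow_mul h]
    exact mem_gridInterval_zero_iff (by positivity)
  constructor
  · rintro ⟨⟨⟨j, hj⟩, hk⟩, h1, h2⟩
    choose k hk using hk
    refine ⟨(j, k), ?_, Prod.ext hj.symm (by ext i; exact (hk i).symm)⟩
    rw [cellIndices, Finset.mem_product, Fintype.mem_piFinset]
    refine ⟨(ht j).1 (hj ▸ h1), fun i => (hs _).1 ?_⟩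
    rw [spaceCube_eq] at h2
    exact hk i ▸ h2 i
  · rintro ⟨⟨j, k⟩, hp, rfl⟩
    rw [cellIndices, Finset.mem_product, Fintype.mem_piFinset] at hp
    refine ⟨⟨⟨j, rfl⟩, fun i => ⟨k i, rfl⟩⟩, (ht j).2 hp.1, ?_⟩
    rw [spaceCube_eq]
    exact fun i => (hs _).2 (hp.2 i)

lemma shift_parCyl (d m : ℕ) (p : ℤ × (Fin d → ℤ)) :
    shift (cellCentre d m p) (parCyl d m) = parCell d m p := by
  have hi : ∀ (r : ℝ) (j : ℤ) (x : ℝ), x - r * j ∈ gridInterval r 0 ↔ x ∈ gridInterval r j := by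
    intro r j x
    simp only [gridInterval, mem_Ioo, Int.cast_zero, mul_zero]
    constructor <;> rintro ⟨h1, h2⟩ <;> constructor <;> linarith
  ext q
  rw [shift, image_add_left, mem_preimage, parCyl, parCell, timeInterval_eq, spaceCube_eq,
    mem_prod, mem_prod]
  refine and_congr ?_ (forall_congr' fun i => ?_)
  · rw [← hi _ p.1 q.1]
    simp [cellCentre, neg_add_eq_sub]
  · rw [← hi _ (p.2 i) (q.2 i)]
    simp [cellCentre, neg_add_eq_sub]

lemma rmsAverages_sq (d : ℕ) {m n : ℕ} (h : m ≤ n) (f : SpaceTime d → ℝ) :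
    rmsAverages d m n f ^ 2 = ((cellIndices d m n).card : ℝ)⁻¹ *
      ∑ p ∈ cellIndices d m n, (⨍ q in parCell d m p, f q) ^ 2 := by
  rw [rmsAverages, Real.sq_sqrt (by positivity), toFinset_latticePoints d h,
    Finset.card_image_of_injective _ (cellCentre_injective d m),
    Finset.sum_image (cellCentre_injective d m).injOn]
  simp_rw [shift_parCyl, sq_abs]

/-! ### Normalized norms -/

section Norms

lemma normL2_sq {X F : Type*} [MeasureSpace X] [NormedAddCommGroup F] (V : Set X) (f : X → F) :
    normL2 V f ^ 2 = (volume V)⁻¹ * ∫⁻ x in V, ‖f x‖ₑ ^ 2 := by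
  rw [normL2, rpow_half_sq, setLAverage_eq, ENNReal.div_eq_inv_mul]

lemma normL2_congr {X F : Type*} [MeasureSpace X] [NormedAddCommGroup F] {V : Set X} {f g : X → F}
    (h : f =ᵐ[volume.restrict V] g) : normL2 V f = normL2 V g := by
  rw [← sq_rpow_half (normL2 V f), ← sq_rpow_half (normL2 V g), normL2_sq, normL2_sq]
  congr 2
  exact lintegral_congr_ae (h.mono fun x hx => by simp only [hx])

lemma normL2_const_smul {X F : Type*} [MeasureSpace X] [NormedAddCommGroup F] [NormedSpace ℝ F]
    (V : Set X) (c : ℝ) (f : X → F) : normL2 V (c • f) = ‖c‖ₑ * normL2 V f := by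
  rw [← sq_rpow_half (normL2 V (c • f)), ← sq_rpow_half (‖c‖ₑ * normL2 V f), mul_pow, normL2_sq,
    normL2_sq]
  simp_rw [Pi.smul_apply, enorm_smul, mul_pow]
  rw [lintegral_const_mul' _ _ (by simp), mul_left_comm]

variable {d : ℕ} {U : Set (Space d)}

lemma normH1_const_smul (c : ℝ) (v : H10 U) :
    normH1 U (c • v).1.fst (c • v).1.snd = ‖c‖ₑ * normH1 U v.1.fst v.1.snd := by
  have h1 : ((c • v).1.fst : Space d → ℝ) =ᵐ[volume.restrict U] c • (v.1.fst : Space d → ℝ) :=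
    Lp.coeFn_smul c v.1.fst
  have h2 : ((c • v).1.snd : Space d → Space d) =ᵐ[volume.restrict U]
      c • (v.1.snd : Space d → Space d) :=
    Lp.coeFn_smul c v.1.snd
  rw [normH1, normL2_congr h1, normL2_congr h2, normL2_const_smul, normL2_const_smul, normH1]
  ring

/-- By homogeneity: `N⁻¹ • v` is in the unit ball. Any positive upper bound `N` serves, which avoids
dividing by a norm that may vanish. -/
lemma ofReal_apply_le_normHminus1 (T : Hminus1 U) (v : H10 U) {N : ℝ} (hN : 0 < N)
    (h : normH1 U v.1.fst v.1.snd ≤ ENNReal.ofReal N) :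
    ENNReal.ofReal ((volume.real U)⁻¹ * T v) ≤ ENNReal.ofReal N * normHminus1 U T := by
  have h1 : normH1 U (N⁻¹ • v).1.fst (N⁻¹ • v).1.snd ≤ 1 := by
    rw [normH1_const_smul, ← ofReal_norm, Real.norm_of_nonneg (by positivity),
      ENNReal.ofReal_inv_of_pos hN]
    calc _ ≤ (ENNReal.ofReal N)⁻¹ * ENNReal.ofReal N := by gcongr
      _ = 1 := ENNReal.inv_mul_cancel (by simpa using hN) (by simp)
  have h2 : ENNReal.ofReal ((volume.real U)⁻¹ * T (N⁻¹ • v)) ≤ normHminus1 U T :=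
    le_iSup₂_of_le (f := fun (u : H10 U) (_ : normH1 U u.1.fst u.1.snd ≤ 1) =>
      ENNReal.ofReal ((volume.real U)⁻¹ * T u)) (N⁻¹ • v) h1 le_rfl
  calc ENNReal.ofReal ((volume.real U)⁻¹ * T v)
      = ENNReal.ofReal N * ENNReal.ofReal ((volume.real U)⁻¹ * T (N⁻¹ • v)) := by
        rw [← ENNReal.ofReal_mul hN.le, map_smul, smul_eq_mul]
        congr 1
        field_simp
    _ ≤ _ := by gcongr

end Norms

/-! ### Rescaled bump functions -/

lemma norm_gradient_eq {d : ℕ} (φ : Space d → ℝ) (x : Space d) :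
    ‖gradient φ x‖ = ‖fderiv ℝ φ x‖ := by
  simp [gradient]

lemma exists_test_function (d : ℕ) :
    ∃ ψ : Space d → ℝ, IsTestFunction (gridCube d 1 0) ψ ∧ ∫ x, ψ x = 1 := by
  -- The outer radius `1 / 4` keeps the closed support inside the open cube of half-side `1 / 2`.
  let b : ContDiffBump (0 : Space d) := ⟨1 / 8, 1 / 4, by norm_num, by norm_num⟩
  refine ⟨b.normed volume, ⟨b.contDiff_normed, b.hasCompactSupport_normed, ?_⟩, b.integral_normed⟩
  rw [b.tsupport_normed_eq]
  intro x hx i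
  have h1 : ‖x‖ ≤ 1 / 4 := by simpa [b] using hx
  have h2 := abs_le.1 (((PiLp.norm_apply_le x i).trans h1))
  simp only [gridInterval, mem_Ioo, Pi.zero_apply, Int.cast_zero]
  constructor <;> linarith [h2.1, h2.2]

/-- All bumps are translates and dilates of a single one, so `M` depends on `d` only. -/
lemma exists_rescaled_test_function (d : ℕ) : ∃ M : ℝ, 0 < M ∧ ∀ r : ℝ, 0 < r →
    ∀ k : Fin d → ℤ, ∃ ψ : Space d → ℝ, IsTestFunction (gridCube d r k) ψ ∧ ∫ x, ψ x = 1 ∧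
      (∀ x, ‖ψ x‖ ≤ M * (r ^ d)⁻¹) ∧ ∀ x, ‖gradient ψ x‖ ≤ M * (r ^ d)⁻¹ * r⁻¹ := by
  obtain ⟨ψ, hψ, h1⟩ := exists_test_function d
  obtain ⟨M₁, hM₁⟩ : ∃ M, ∀ x, ‖fderiv ℝ ψ x‖ ≤ M :=
    hψ.continuous_fderiv.bounded_above_of_compact_support (hψ.2.1.fderiv ℝ)
  obtain ⟨M₂, hM₂⟩ : ∃ M, ∀ x, ‖ψ x‖ ≤ M :=
    hψ.1.continuous.bounded_above_of_compact_support hψ.2.1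
  refine ⟨max 1 (max M₁ M₂), by positivity, fun r hr k => ?_⟩
  let c : Space d := WithLp.toLp 2 fun i => r * (k i : ℝ)
  let e : Space d ≃ₜ Space d :=
    (Homeomorph.subRight c).trans (Homeomorph.smulOfNeZero r⁻¹ (inv_ne_zero hr.ne'))
  have he : ∀ x, e x = r⁻¹ • (x - c) := fun x => rfl
  refine ⟨(r ^ d)⁻¹ • (ψ ∘ e), IsTestFunction.const_smul ⟨?_, ?_, ?_⟩ _, ?_, fun x => ?_, fun x => ?_⟩
  · refine hψ.1.comp ?_
    change ContDiff ℝ ∞ fun x => r⁻¹ • (x - c)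
    fun_prop
  · exact hψ.2.1.comp_homeomorph e
  · rw [tsupport_comp_eq_preimage ψ e]
    intro x hx i
    have hi := hψ.2.2 hx i
    simp only [he, gridInterval, mem_Ioo, Pi.zero_apply, Int.cast_zero, PiLp.smul_apply,
      PiLp.sub_apply, smul_eq_mul, c] at hi
    obtain ⟨h3, h4⟩ := hi
    rw [inv_mul_eq_div, lt_div_iff₀ hr] at h3
    rw [inv_mul_eq_div, div_lt_iff₀ hr] at h4
    constructor <;> linarith
  · simp only [Pi.smul_apply, Function.comp_apply, he, smul_eq_mul]
    rw [integral_const_mul, integral_sub_right_eq_self (fun x => ψ (r⁻¹ • x)) c,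
      Measure.integral_comp_inv_smul, h1, finrank_euclideanSpace_fin, abs_of_pos (by positivity),
      smul_eq_mul, mul_one, inv_mul_cancel₀ (by positivity)]
  · rw [Pi.smul_apply, norm_smul, Real.norm_of_nonneg (by positivity), mul_comm]
    gcongr
    exact (hM₂ _).trans (le_max_of_le_right (le_max_right _ _))
  · have hd : HasFDerivAt (ψ ∘ e) ((fderiv ℝ ψ (e x)).comp (r⁻¹ • ContinuousLinearMap.id ℝ _)) x := by
      refine (hψ.differentiable (e x)).hasFDerivAt.comp x ?_
      exact ((hasFDerivAt_id x).sub_const c).const_smul r⁻¹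
    rw [norm_gradient_eq, (hd.const_smul _).fderiv, ContinuousLinearMap.comp_smul,
      ContinuousLinearMap.comp_id, norm_smul, norm_smul, Real.norm_of_nonneg (by positivity),
      Real.norm_of_nonneg (by positivity)]
    calc (r ^ d)⁻¹ * (r⁻¹ * ‖fderiv ℝ ψ (e x)‖)
        ≤ (r ^ d)⁻¹ * (r⁻¹ * max 1 (max M₁ M₂)) := by
          gcongr
          exact (hM₁ _).trans (le_max_of_le_right (le_max_left _ _))
      _ = _ := by ring

/-! ### Test functions as elements of `H¹_0` -/

section H10

variable {d : ℕ} {U : Set (Space d)}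

lemma IsTestFunction.continuous_gradient {φ : Space d → ℝ} (h : IsTestFunction U φ) :
    Continuous (gradient φ) :=
  (InnerProductSpace.toDual ℝ (Space d)).symm.continuous.comp h.continuous_fderiv

lemma IsTestFunction.gradient_zero_of_notMem {φ : Space d → ℝ} (h : IsTestFunction U φ)
    {x : Space d} (hx : x ∉ U) : gradient φ x = 0 := by
  simp [gradient, h.fderiv_zero_of_notMem hx]

lemma IsTestFunction.memLp_gradient {φ : Space d → ℝ} (h : IsTestFunction U φ) (p : ℝ≥0∞) :
    MemLp (gradient φ) p volume :=
  h.continuous_gradient.memLp_of_hasCompactSupport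
    ((h.2.1.fderiv ℝ).comp_left (g := (InnerProductSpace.toDual ℝ (Space d)).symm) (map_zero _))

/-- A test function as an element of `H¹_0(U)`. -/
def IsTestFunction.toH10 {φ : Space d → ℝ} (h : IsTestFunction U φ) : H10 U :=
  ⟨WithLp.toLp 2 (((h.memLp 2).restrict U).toLp φ, ((h.memLp_gradient 2).restrict U).toLp (gradient φ)),
    Submodule.le_topologicalClosure _ (Submodule.subset_span
      ⟨φ, h, ((h.memLp 2).restrict U).coeFn_toLp, ((h.memLp_gradient 2).restrict U).coeFn_toLp⟩)⟩

lemma IsTestFunction.toH10_fst {φ : Space d → ℝ} (h : IsTestFunction U φ) :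
    h.toH10.1.fst =ᵐ[volume.restrict U] φ :=
  ((h.memLp 2).restrict U).coeFn_toLp

lemma IsTestFunction.toH10_snd {φ : Space d → ℝ} (h : IsTestFunction U φ) :
    h.toH10.1.snd =ᵐ[volume.restrict U] gradient φ :=
  ((h.memLp_gradient 2).restrict U).coeFn_toLp

variable {ι : Type*} (S : Finset ι) {ψ : ι → Space d → ℝ} (hψ : ∀ i, IsTestFunction U (ψ i))
  (c : ι → ℝ)

lemma sum_toH10_fst : (∑ i ∈ S, c i • (hψ i).toH10 : H10 U).1.fst =ᵐ[volume.restrict U]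
    fun x => ∑ i ∈ S, c i * ψ i x := by
  classical
  induction S using Finset.induction_on with
  | empty => exact Lp.coeFn_zero ℝ 2 (volume.restrict U)
  | insert i S hi ih =>
    rw [Finset.sum_insert hi]
    have h1 := Lp.coeFn_add (c i • (hψ i).toH10 : H10 U).1.fst
      (∑ i ∈ S, c i • (hψ i).toH10 : H10 U).1.fst
    have h2 := Lp.coeFn_smul (c i) (hψ i).toH10.1.fst
    filter_upwards [h1, h2, ih, (hψ i).toH10_fst] with x h1 h2 h3 h4
    refine h1.trans ?_
    rw [Finset.sum_insert hi, Pi.add_apply, h3]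
    congr 1
    refine h2.trans ?_
    rw [Pi.smul_apply, h4, smul_eq_mul]

lemma sum_toH10_snd : (∑ i ∈ S, c i • (hψ i).toH10 : H10 U).1.snd =ᵐ[volume.restrict U]
    fun x => ∑ i ∈ S, c i • gradient (ψ i) x := by
  classical
  induction S using Finset.induction_on with
  | empty => exact Lp.coeFn_zero (Space d) 2 (volume.restrict U)
  | insert i S hi ih =>
    rw [Finset.sum_insert hi]
    have h1 := Lp.coeFn_add (c i • (hψ i).toH10 : H10 U).1.snd
      (∑ i ∈ S, c i • (hψ i).toH10 : H10 U).1.snd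
    have h2 := Lp.coeFn_smul (c i) (hψ i).toH10.1.snd
    filter_upwards [h1, h2, ih, (hψ i).toH10_snd] with x h1 h2 h3 h4
    refine h1.trans ?_
    rw [Finset.sum_insert hi, Pi.add_apply, h3]
    congr 1
    refine h2.trans ?_
    rw [Pi.smul_apply, h4]

end H10

/-- The square integral of a combination of functions supported in disjoint cells. -/
lemma IsTiling.lintegral_sum_smul_le {X ι F : Type*} [MeasureSpace X] [NormedAddCommGroup F]
    [NormedSpace ℝ F] {S : Finset ι} {Q : ι → Set X} {U : Set X} (h : IsTiling S Q U)
    {g : ι → X → F} (hg : ∀ i ∈ S, ∀ x ∉ Q i, g i x = 0) {A : ℝ}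
    (hb : ∀ i ∈ S, ∀ x, ‖g i x‖ ≤ A)
    {q : ℝ} (hq : 0 ≤ q) (hQ : ∀ i ∈ S, volume (Q i) = ENNReal.ofReal q) (c : ι → ℝ) :
    ∫⁻ x in U, ‖∑ i ∈ S, c i • g i x‖ₑ ^ 2 ≤ ENNReal.ofReal (A ^ 2 * q * ∑ i ∈ S, c i ^ 2) := by
  rw [h.lintegral_eq, Finset.mul_sum, ENNReal.ofReal_sum_of_nonneg fun i _ => by positivity]
  refine Finset.sum_le_sum fun i hi => ?_
  calc ∫⁻ x in Q i, ‖∑ j ∈ S, c j • g j x‖ₑ ^ 2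
      ≤ ∫⁻ _ in Q i, ENNReal.ofReal (A ^ 2 * c i ^ 2) := by
        refine setLIntegral_mono_ae' (h.measurableSet i hi) (Filter.Eventually.of_forall fun x hx => ?_)
        -- On the tile `Q i` all summands but the `i`-th vanish, so there are no cross terms.
        rw [Finset.sum_eq_single i]
        · rw [← ofReal_norm, ← ENNReal.ofReal_pow (norm_nonneg _), norm_smul, mul_pow, mul_comm,
            Real.norm_eq_abs, sq_abs]
          refine ENNReal.ofReal_le_ofReal ?_
          gcongr
          exact hb i hi x
        · intro j hj hji
          rw [hg j hj, smul_zero]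
          exact fun hx' => disjoint_left.1 (h.pairwiseDisjoint hj hi hji) hx' hx
        · exact fun h' => absurd hi h'
    _ = ENNReal.ofReal (A ^ 2 * q * c i ^ 2) := by
        rw [setLIntegral_const, hQ i hi, ← ENNReal.ofReal_mul (by positivity)]
        congr 1
        ring

/-- The pairings of a functional with rescaled bumps in the cells of a grid are square summable,
with a bound in terms of the norm of the functional. -/
lemma sum_sq_apply_le {d : ℕ} (hd : d ≠ 0) {m n : ℕ} (hmn : m ≤ n) {M : ℝ} (hM : 0 < M)
    {ψ : (Fin d → ℤ) → Space d → ℝ}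
    (hψ : ∀ k ∈ Fintype.piFinset fun _ : Fin d => centeredInts (n - m),
      IsTestFunction (gridCube d (3 ^ m) k) (ψ k))
    (hψU : ∀ k, IsTestFunction (spaceCube d n) (ψ k))
    (h1 : ∀ k x, ‖ψ k x‖ ≤ M * ((3 ^ m) ^ d)⁻¹)
    (h2 : ∀ k x, ‖gradient (ψ k) x‖ ≤ M * ((3 ^ m) ^ d)⁻¹ * (3 ^ m)⁻¹)
    (T : Hminus1 (spaceCube d n)) :
    ∑ k ∈ Fintype.piFinset fun _ : Fin d => centeredInts (n - m), ‖T (hψU k).toH10‖ₑ ^ 2 ≤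
      ENNReal.ofReal (4 * M ^ 2 * ((3 ^ m) ^ d)⁻¹ * ((3 ^ m)⁻¹) ^ 2 * (3 ^ n) ^ d) *
        normHminus1 (spaceCube d n) T ^ 2 := by
  set S := Fintype.piFinset fun _ : Fin d => centeredInts (n - m) with hS
  set c : (Fin d → ℤ) → ℝ := fun k => T (hψU k).toH10 with hc
  set s : ℝ := ∑ k ∈ S, c k ^ 2 with hs
  set r : ℝ := 3 ^ m with hr
  set R : ℝ := 3 ^ n with hR
  have hr0 : 0 < r := by positivity
  have hR0 : 0 < R := by positivity
  have hrR : r ≤ R := pow_le_pow_right₀ (by norm_num) hmn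
  have hs' : ∑ k ∈ S, ‖T (hψU k).toH10‖ₑ ^ 2 = ENNReal.ofReal s := by
    rw [hs, ENNReal.ofReal_sum_of_nonneg fun _ _ => sq_nonneg _]
    refine Finset.sum_congr rfl fun k _ => ?_
    rw [← ofReal_norm, ← ENNReal.ofReal_pow (norm_nonneg _), Real.norm_eq_abs, sq_abs]
  rw [hs']
  have hs0 : 0 ≤ s := Finset.sum_nonneg fun k _ => sq_nonneg (c k)
  -- The duality argument divides by `s` at the end, so the trivial case is removed.
  rcases hs0.eq_or_lt with h0 | h0
  · rw [← h0, ENNReal.ofReal_zero]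
    exact zero_le
  have hT := isTiling_spaceCube d hmn
  -- The coefficients are the pairings themselves, so that `T v` is exactly the sum of squares `s`,
  -- while the squared norm of `v` is also linear in `s`.
  let v : H10 (spaceCube d n) := ∑ k ∈ S, c k • (hψU k).toH10
  have hTv : T v = s := by
    simp only [v, map_sum, map_smul, smul_eq_mul, hs, sq]
    rfl
  have hvol : volume (spaceCube d n) = ENNReal.ofReal (R ^ d) := volume_spaceCube d n
  have hfst : ∫⁻ x in spaceCube d n, ‖v.1.fst x‖ₑ ^ 2 ≤
      ENNReal.ofReal ((M * (r ^ d)⁻¹) ^ 2 * r ^ d * s) := by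
    have e : ∫⁻ x in spaceCube d n, ‖v.1.fst x‖ₑ ^ 2 =
        ∫⁻ x in spaceCube d n, ‖∑ k ∈ S, c k • ψ k x‖ₑ ^ 2 :=
      lintegral_congr_ae ((sum_toH10_fst S hψU c).mono fun x hx => by
        simp only [v, hx, smul_eq_mul])
    rw [e]
    exact hT.lintegral_sum_smul_le (fun k hk x hx => (hψ k hk).zero_of_notMem hx)
      (fun k _ x => h1 k x) (by positivity) (fun k _ => volume_gridCube d hr0.le k) c
  have hsnd : ∫⁻ x in spaceCube d n, ‖v.1.snd x‖ₑ ^ 2 ≤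
      ENNReal.ofReal ((M * (r ^ d)⁻¹ * r⁻¹) ^ 2 * r ^ d * s) := by
    have e : ∫⁻ x in spaceCube d n, ‖v.1.snd x‖ₑ ^ 2 =
        ∫⁻ x in spaceCube d n, ‖∑ k ∈ S, c k • gradient (ψ k) x‖ₑ ^ 2 :=
      lintegral_congr_ae ((sum_toH10_snd S hψU c).mono fun x hx => by
        simp only [v, hx])
    rw [e]
    exact hT.lintegral_sum_smul_le (fun k hk x hx => (hψ k hk).gradient_zero_of_notMem hx)
      (fun k _ x => h2 k x) (by positivity) (fun k _ => volume_gridCube d hr0.le k) c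
  -- `P` bounds the square of each of the two terms of the H¹ norm of `v`; for the zeroth-order
  -- term, `R⁻¹ ≤ r⁻¹` is used.
  set P : ℝ := (R ^ d)⁻¹ * ((M * (r ^ d)⁻¹ * r⁻¹) ^ 2 * r ^ d * s) with hP
  have hP0 : 0 < P := by positivity
  have hsqrt : ∀ a : ℝ≥0∞, a ^ 2 ≤ ENNReal.ofReal P → a ≤ ENNReal.ofReal (Real.sqrt P) := by
    intro a ha
    refine le_of_not_gt fun h => ?_
    have h' : ENNReal.ofReal (Real.sqrt P) ^ 2 < a ^ 2 := ENNReal.pow_lt_pow_left two_ne_zero h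
    rw [← ENNReal.ofReal_pow (Real.sqrt_nonneg _), Real.sq_sqrt hP0.le] at h'
    exact absurd ha (not_le.2 h')
  have hN : normH1 (spaceCube d n) v.1.fst v.1.snd ≤ ENNReal.ofReal (2 * Real.sqrt P) := by
    rw [two_mul, ENNReal.ofReal_add (by positivity) (by positivity), normH1]
    refine add_le_add (hsqrt _ ?_) (hsqrt _ ?_)
    · have e : volume (spaceCube d n) ^ (-(1 / (d : ℝ))) = ENNReal.ofReal R⁻¹ := by
        rw [hvol, ENNReal.ofReal_rpow_of_pos (by positivity), ← Real.rpow_natCast,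
          ← Real.rpow_mul hR0.le, mul_neg, mul_one_div_cancel (by exact_mod_cast hd),
          Real.rpow_neg_one]
      rw [e, mul_pow, normL2_sq, hvol, ← ENNReal.ofReal_inv_of_pos (by positivity),
        ← ENNReal.ofReal_pow (by positivity)]
      calc _ ≤ ENNReal.ofReal (r⁻¹ ^ 2) * (ENNReal.ofReal (R ^ d)⁻¹ *
            ENNReal.ofReal ((M * (r ^ d)⁻¹) ^ 2 * r ^ d * s)) := by gcongr
        _ = ENNReal.ofReal P := by
          rw [← ENNReal.ofReal_mul (by positivity), ← ENNReal.ofReal_mul (by positivity)]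
          congr 1
          ring
    · rw [normL2_sq, hvol, ← ENNReal.ofReal_inv_of_pos (by positivity)]
      calc _ ≤ ENNReal.ofReal (R ^ d)⁻¹ *
            ENNReal.ofReal ((M * (r ^ d)⁻¹ * r⁻¹) ^ 2 * r ^ d * s) := by gcongr
        _ = ENNReal.ofReal P := by rw [← ENNReal.ofReal_mul (by positivity)]
  have hfin := pow_le_pow_left' (ofReal_apply_le_normHminus1 T v (by positivity) hN) 2
  rw [hTv, mul_pow, ← ENNReal.ofReal_pow (by positivity), ← ENNReal.ofReal_pow (by positivity),
    mul_pow 2, Real.sq_sqrt hP0.le, measureReal_def, hvol,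
    ENNReal.toReal_ofReal (by positivity)] at hfin
  -- The duality bound is quadratic in `s` on the left and linear, through `P`, on the right;
  -- multiplying by `R ^ (2 d) / s` leaves the claim.
  calc ENNReal.ofReal s
      = ENNReal.ofReal (R ^ d * R ^ d / s) * ENNReal.ofReal (((R ^ d)⁻¹ * s) ^ 2) := by
        rw [← ENNReal.ofReal_mul (by positivity)]
        congr 1
        field_simp
    _ ≤ ENNReal.ofReal (R ^ d * R ^ d / s) * (ENNReal.ofReal (2 ^ 2 * P) *
          normHminus1 (spaceCube d n) T ^ 2) := by gcongr
    _ = _ := by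
        rw [← mul_assoc, ← ENNReal.ofReal_mul (by positivity)]
        congr 2
        rw [hP]
        field_simp
        ring

/-! ### Slices of square integrable functions -/

section Slices

variable {X Y F : Type*} [MeasurableSpace X] [MeasurableSpace Y] [NormedAddCommGroup F]
  {μ : Measure X} {ν : Measure Y} [SFinite ν]

lemma lintegral_lintegral_enorm_sq {f : X × Y → F} (hf : MemLp f 2 (μ.prod ν)) :
    ∫⁻ x, ∫⁻ y, ‖f (x, y)‖ₑ ^ 2 ∂ν ∂μ = ∫⁻ p, ‖f p‖ₑ ^ 2 ∂(μ.prod ν) :=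
  (lintegral_prod _ (hf.1.enorm.pow_const 2)).symm

lemma ae_memLp_slice [SFinite μ] {f : X × Y → F} (hf : MemLp f 2 (μ.prod ν)) :
    ∀ᵐ x ∂μ, MemLp (fun y => f (x, y)) 2 ν := by
  have h1 : ∀ᵐ x ∂μ, ∫⁻ y, ‖f (x, y)‖ₑ ^ 2 ∂ν < ⊤ := by
    refine ae_lt_top' (hf.1.enorm.pow_const 2).lintegral_prod_right' ?_
    rw [lintegral_lintegral_enorm_sq hf]
    exact lintegral_enorm_sq_ne_top hf
  filter_upwards [h1, hf.1.prodMk_left] with x hx hx'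
  exact memLp_two_of_lintegral_ne_top hx' hx.ne

lemma memLp_integral_mul [SFinite μ] {w : X × Y → ℝ} (hw : MemLp w 2 (μ.prod ν)) {e : Y → ℝ}
    (he : MemLp e 2 ν) : MemLp (fun x => ∫ y, w (x, y) * e y ∂ν) 2 μ := by
  refine memLp_two_of_lintegral_ne_top ?_ (ne_top_of_le_ne_top
    (b := (∫⁻ p, ‖w p‖ₑ ^ 2 ∂(μ.prod ν)) * ∫⁻ y, ‖e y‖ₑ ^ 2 ∂ν) ?_ ?_)
  · exact (hw.1.mul he.1.comp_snd).integral_prod_right'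
  · exact ENNReal.mul_ne_top (lintegral_enorm_sq_ne_top hw) (lintegral_enorm_sq_ne_top he)
  · rw [← lintegral_lintegral_enorm_sq hw, ← lintegral_mul_const' _ _ (lintegral_enorm_sq_ne_top he)]
    refine lintegral_mono_ae ?_
    filter_upwards [ae_memLp_slice hw] with x hx
    exact enorm_integral_mul_sq_le hx.1 he.1

end Slices

/-! ### Poincaré inequalities on the cells -/

/-- The cube of side `2 r` serves as the set `B` of translations in the Poincaré inequality. -/
lemma gridCube_sub_mem {d : ℕ} {r : ℝ} {k : Fin d → ℤ} {x y : Space d} (hx : x ∈ gridCube d r k)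
    (hy : y ∈ gridCube d r k) : y - x ∈ gridCube d (2 * r) 0 := by
  intro i
  obtain ⟨h1, h2⟩ := hx i
  obtain ⟨h3, h4⟩ := hy i
  simp only [gridInterval, mem_Ioo, Pi.zero_apply, Int.cast_zero, PiLp.sub_apply]
  constructor <;> linarith

lemma norm_sq_le_of_mem_gridCube {d : ℕ} {r : ℝ} {a : Space d}
    (ha : a ∈ gridCube d (2 * r) 0) : ‖a‖ ^ 2 ≤ d * r ^ 2 := by
  rw [EuclideanSpace.norm_sq_eq]
  calc ∑ i, ‖a i‖ ^ 2 ≤ ∑ _i : Fin d, r ^ 2 := by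
        refine Finset.sum_le_sum fun i _ => ?_
        obtain ⟨h1, h2⟩ := ha i
        simp only [Pi.zero_apply, Int.cast_zero] at h1 h2
        rw [Real.norm_eq_abs, sq_abs]
        nlinarith
    _ = d * r ^ 2 := by simp

/-- The Poincaré inequality on a cube for a function with a weak gradient. -/
lemma lintegral_sub_weighted_average_le {d : ℕ} {U : Set (Space d)} {u : Space d → ℝ}
    {G : Space d → Space d} (hu : MemLp u 2 (volume.restrict U))
    (hG : MemLp G 2 (volume.restrict U)) (h : HasWeakGradient U u G) (hU : IsOpen U) {r : ℝ}
    (hr : 0 < r) {k : Fin d → ℤ} (hQ : gridCube d r k ⊆ U) {M : ℝ} (hM : 0 < M)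
    {ψ : Space d → ℝ} (hψ : IsTestFunction (gridCube d r k) ψ) (hψ1 : ∫ x, ψ x = 1)
    (hψM : ∀ x, ‖ψ x‖ ≤ M * (r ^ d)⁻¹) :
    ∫⁻ x in gridCube d r k, ‖u x - ∫ y in gridCube d r k, u y * ψ y‖ₑ ^ 2 ≤
      ENNReal.ofReal (M ^ 2 * 2 ^ d * d * r ^ 2) * ∫⁻ x in gridCube d r k, ‖G x‖ₑ ^ 2 := by
  set Q := gridCube d r k with hQdef
  have hQo : IsOpen Q := isOpen_gridCube _ _ _
  have hvQ : volume Q = ENNReal.ofReal (r ^ d) := volume_gridCube d hr.le k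
  have hGQ : MemLp G 2 (volume.restrict Q) := hG.mono_measure (Measure.restrict_mono_set _ hQ)
  have key : ∀ a ∈ gridCube d (2 * r) 0, ∀ φ : Space d → ℝ, IsTestFunction Q φ →
      ‖∫ x in Q, u x * fderiv ℝ φ x a‖ₑ ^ 2 ≤
        (ENNReal.ofReal (d * r ^ 2) * ∫⁻ x in Q, ‖G x‖ₑ ^ 2) * ∫⁻ x, ‖φ x‖ₑ ^ 2 := by
    intro a ha φ hφ
    have e0 : ∀ x, fderiv ℝ φ x a = inner ℝ a (gradient φ x) := fun x => by
      rw [real_inner_comm, gradient, InnerProductSpace.toDual_symm_apply]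
    have hφU := hφ.mono hQ
    have i1 : Integrable (fun x => u x • gradient φ x) (volume.restrict U) :=
      memLp_one_iff_integrable.1 (((hφU.memLp_gradient 2).restrict U).smul hu)
    have i2 : Integrable (fun x => φ x • G x) (volume.restrict U) :=
      memLp_one_iff_integrable.1 (hG.smul ((hφU.memLp 2).restrict U))
    -- The weak gradient is tested on all of `U`; the support of `φ` reduces both sides to the cell.
    have e1 : ∫ x in Q, u x * fderiv ℝ φ x a = -∫ x in Q, inner ℝ (φ x • a) (G x) := by
      calc ∫ x in Q, u x * fderiv ℝ φ x a = ∫ x in U, u x * fderiv ℝ φ x a := by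
            refine (setIntegral_eq_of_subset_of_forall_sdiff_eq_zero hU.measurableSet hQ
              fun x hx => ?_).symm
            rw [hφ.fderiv_zero_of_notMem hx.2]
            simp
        _ = inner ℝ a (∫ x in U, u x • gradient φ x) := by
            rw [← integral_inner i1]
            simp_rw [e0, inner_smul_right]
        _ = -∫ x in U, inner ℝ (φ x • a) (G x) := by
            rw [h φ hφU, inner_neg_right, ← integral_inner i2]
            simp_rw [inner_smul_right, inner_smul_left]
            rfl
        _ = -∫ x in Q, inner ℝ (φ x • a) (G x) := by
            congr 1
            refine setIntegral_eq_of_subset_of_forall_sdiff_eq_zero hU.measurableSet hQ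
              fun x hx => ?_
            rw [hφ.zero_of_notMem hx.2]
            simp
    rw [e1, enorm_neg]
    refine (enorm_integral_inner_sq_le (f := fun x => φ x • a) (hφ.1.continuous.smul
      continuous_const).aestronglyMeasurable hGQ.1).trans ?_
    simp_rw [enorm_smul, mul_pow]
    rw [lintegral_mul_const' _ _ (by simp), mul_comm _ (‖a‖ₑ ^ 2), mul_assoc, mul_assoc,
      mul_comm (∫⁻ x in Q, ‖φ x‖ₑ ^ 2)]
    gcongr
    · rw [← ofReal_norm, ← ENNReal.ofReal_pow (norm_nonneg _)]
      exact ENNReal.ofReal_le_ofReal (norm_sq_le_of_mem_gridCube ha)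
    · exact Measure.restrict_le_self
  have hψ1' : ∫ x in Q, ψ x = 1 := by
    rw [setIntegral_eq_integral_of_forall_compl_eq_zero fun x hx => hψ.zero_of_notMem hx, hψ1]
  have hψ2 : ∫⁻ x in Q, ‖ψ x‖ₑ ^ 2 ≤ ENNReal.ofReal (M ^ 2 * (r ^ d)⁻¹) := by
    calc ∫⁻ x in Q, ‖ψ x‖ₑ ^ 2 ≤ ∫⁻ _ in Q, ENNReal.ofReal ((M * (r ^ d)⁻¹) ^ 2) := by
          refine lintegral_mono fun x => ?_
          rw [← ofReal_norm, ← ENNReal.ofReal_pow (norm_nonneg _)]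
          refine ENNReal.ofReal_le_ofReal ?_
          gcongr
          exact hψM x
      _ = _ := by
          rw [setLIntegral_const, hvQ, ← ENNReal.ofReal_mul (by positivity)]
          congr 1
          field_simp
  refine (lintegral_sub_average_sq_le hQo (convex_gridCube _ _ _) (by simp [hvQ])
    (isOpen_gridCube d (2 * r) 0).measurableSet (fun x hx y hy => gridCube_sub_mem hx hy)
    (hu.mono_measure (Measure.restrict_mono_set _ hQ)) key ((hψ.memLp 2).restrict Q) hψ1').trans ?_
  rw [volume_gridCube d (by positivity), ← mul_assoc, ← mul_assoc]
  refine mul_le_mul_left ?_ _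
  rw [mul_assoc]
  calc _ ≤ ENNReal.ofReal (M ^ 2 * (r ^ d)⁻¹) *
        (ENNReal.ofReal ((2 * r) ^ d) * ENNReal.ofReal (d * r ^ 2)) := by gcongr
    _ = _ := by
      rw [← ENNReal.ofReal_mul (by positivity), ← ENNReal.ofReal_mul (by positivity)]
      congr 1
      rw [mul_pow]
      field_simp

/-- The Poincaré inequality on an interval for a function with a weak derivative. -/
lemma lintegral_sub_time_average_le {I : Set ℝ} (hI : IsOpen I) {F D : ℝ → ℝ}
    (hF : MemLp F 2 (volume.restrict I)) (hD : MemLp D 2 (volume.restrict I))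
    (h : ∀ η : ℝ → ℝ, IsTestFunction I η → ∫ t in I, η t * D t = -∫ t in I, deriv η t * F t)
    {ρ : ℝ} (hρ : 0 < ρ) {j : ℤ} (hJ : gridInterval ρ j ⊆ I) :
    ∫⁻ t in gridInterval ρ j, ‖F t - ∫ s in gridInterval ρ j, F s * ρ⁻¹‖ₑ ^ 2 ≤
      ENNReal.ofReal (2 * ρ ^ 2) * ∫⁻ t in gridInterval ρ j, ‖D t‖ₑ ^ 2 := by
  set J := gridInterval ρ j with hJdef
  have hJo : IsOpen J := isOpen_gridInterval _ _
  have hvJ : volume J = ENNReal.ofReal ρ := volume_gridInterval ρ j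
  have hfin : IsFiniteMeasure (volume.restrict J) := ⟨by simp [hvJ]⟩
  have hDJ : MemLp D 2 (volume.restrict J) := hD.mono_measure (Measure.restrict_mono_set _ hJ)
  have key : ∀ a ∈ Ioo (-ρ) ρ, ∀ φ : ℝ → ℝ, IsTestFunction J φ →
      ‖∫ x in J, F x * fderiv ℝ φ x a‖ₑ ^ 2 ≤
        (ENNReal.ofReal (ρ ^ 2) * ∫⁻ x in J, ‖D x‖ₑ ^ 2) * ∫⁻ x, ‖φ x‖ₑ ^ 2 := by
    intro a ha φ hφ
    have hφI := hφ.mono hJ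
    have e1 : ∫ x in J, F x * fderiv ℝ φ x a = -(a * ∫ x in J, φ x * D x) := by
      calc ∫ x in J, F x * fderiv ℝ φ x a = ∫ x in I, F x * fderiv ℝ φ x a := by
            refine (setIntegral_eq_of_subset_of_forall_sdiff_eq_zero hI.measurableSet hJ
              fun x hx => ?_).symm
            rw [hφ.fderiv_zero_of_notMem hx.2]
            simp
        _ = a * ∫ x in I, deriv φ x * F x := by
            rw [← integral_const_mul]
            congr 1 with x
            rw [fderiv_eq_smul_deriv, smul_eq_mul]
            ring
        _ = -(a * ∫ x in I, φ x * D x) := by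
            rw [h φ hφI]
            ring
        _ = -(a * ∫ x in J, φ x * D x) := by
            congr 2
            refine setIntegral_eq_of_subset_of_forall_sdiff_eq_zero hI.measurableSet hJ
              fun x hx => ?_
            rw [hφ.zero_of_notMem hx.2]
            simp
    rw [e1, enorm_neg, enorm_mul, mul_pow, mul_assoc, mul_comm (∫⁻ x in J, _)]
    gcongr
    · rw [← ofReal_norm, ← ENNReal.ofReal_pow (norm_nonneg _), Real.norm_eq_abs, sq_abs]
      refine ENNReal.ofReal_le_ofReal ?_
      nlinarith [ha.1, ha.2]
    · refine (enorm_integral_mul_sq_le hφ.1.continuous.aestronglyMeasurable hDJ.1).trans ?_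
      gcongr
      exact Measure.restrict_le_self
  -- In time the plain average is allowed, since the weight need only be square integrable. The
  -- constant is `ρ⁻¹ * (2 * ρ) * ρ ^ 2`.
  refine (lintegral_sub_average_sq_le (ψ := fun _ => ρ⁻¹) hJo (convex_Ioo _ _) (by simp [hvJ])
    (measurableSet_Ioo (a := -ρ) (b := ρ)) ?_
    (hF.mono_measure (Measure.restrict_mono_set _ hJ)) key (memLp_const _) ?_).trans ?_
  · rintro x ⟨h1, h2⟩ y ⟨h3, h4⟩
    constructor <;> linarith
  · rw [setIntegral_const, measureReal_def, hvJ, ENNReal.toReal_ofReal hρ.le, smul_eq_mul,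
      mul_inv_cancel₀ hρ.ne']
  · rw [Real.volume_Ioo, setLIntegral_const, hvJ, ← ofReal_norm,
      ← ENNReal.ofReal_pow (norm_nonneg _), ← mul_assoc, ← mul_assoc,
      Real.norm_of_nonneg (by positivity), ← ENNReal.ofReal_mul (by positivity),
      ← ENNReal.ofReal_mul (by positivity), ← ENNReal.ofReal_mul (by rw [sub_neg_eq_add]; positivity)]
    refine le_of_eq ?_
    congr 2
    field_simp
    ring

/-! ### Consequences of the normalization -/

section Normalization

variable {d n : ℕ} {w : SpaceTime d → ℝ} {G : SpaceTime d → Space d}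
  {T : ℝ → Hminus1 (spaceCube d n)}

lemma volume_timeInterval_ne_zero (n : ℕ) : volume (timeInterval n) ≠ 0 := by
  rw [volume_timeInterval]; simp

lemma volume_timeInterval_ne_top (n : ℕ) : volume (timeInterval n) ≠ ⊤ := by
  rw [volume_timeInterval]; exact ENNReal.ofReal_ne_top

lemma volume_spaceCube_ne_zero (d n : ℕ) : volume (spaceCube d n) ≠ 0 := by
  rw [volume_spaceCube]
  simp only [ne_eq, ENNReal.ofReal_eq_zero, not_le]
  positivity

lemma volume_spaceCube_ne_top (d n : ℕ) : volume (spaceCube d n) ≠ ⊤ := by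
  rw [volume_spaceCube]; exact ENNReal.ofReal_ne_top

lemma restrict_parCyl (d n : ℕ) : (volume : Measure (SpaceTime d)).restrict (parCyl d n) =
    (volume.restrict (timeInterval n)).prod (volume.restrict (spaceCube d n)) := by
  rw [parCyl, Measure.prod_restrict, Measure.volume_eq_prod]

lemma le_mul_of_laverage_rpow_half_le_one {X : Type*} [MeasureSpace X] {V : Set X}
    (h0 : volume V ≠ 0) (ht : volume V ≠ ⊤) {P : X → ℝ≥0∞}
    (h : (⨍⁻ t in V, P t ∂volume) ^ (1 / 2 : ℝ) ≤ 1) : ∫⁻ t in V, P t ≤ volume V := by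
  have h1 := pow_le_pow_left' h 2
  rw [rpow_half_sq, one_pow, setLAverage_eq, ENNReal.div_le_iff h0 ht, one_mul] at h1
  exact h1

lemma lintegral_gradient_sq_le (h : normH1Par (timeInterval n) (spaceCube d n) w G T ≤ 1) :
    ∫⁻ t in timeInterval n, ∫⁻ x in spaceCube d n, ‖G (t, x)‖ₑ ^ 2 ≤ volume (parCyl d n) := by
  have h1 := le_mul_of_laverage_rpow_half_le_one (volume_timeInterval_ne_zero n)
    (volume_timeInterval_ne_top n) (le_self_add.trans h)
  rw [volume_parCyl, mul_comm]
  refine le_trans ?_ (mul_le_mul_right h1 _)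
  rw [← lintegral_const_mul' _ _ (volume_spaceCube_ne_top d n)]
  refine lintegral_mono fun t => ?_
  have h2 : normL2 (spaceCube d n) (fun x => G (t, x)) ^ 2 ≤
      normH1 (spaceCube d n) (fun x => w (t, x)) (fun x => G (t, x)) ^ 2 := by
    gcongr
    exact le_add_self
  rw [normL2_sq] at h2
  calc _ = volume (spaceCube d n) *
        ((volume (spaceCube d n))⁻¹ * ∫⁻ x in spaceCube d n, ‖G (t, x)‖ₑ ^ 2) := by
        rw [← mul_assoc, ENNReal.mul_inv_cancel (volume_spaceCube_ne_zero d n)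
          (volume_spaceCube_ne_top d n), one_mul]
    _ ≤ _ := by gcongr

lemma lintegral_normHminus1_sq_le (h : normH1Par (timeInterval n) (spaceCube d n) w G T ≤ 1) :
    ∫⁻ t in timeInterval n, normHminus1 (spaceCube d n) (T t) ^ 2 ≤ volume (timeInterval n) :=
  le_mul_of_laverage_rpow_half_le_one (volume_timeInterval_ne_zero n)
    (volume_timeInterval_ne_top n) (le_add_self.trans h)

/-- Here `|U|^{-1/d}` equals `3 ^ (-n)`. This bound is what permits zero as the approximation at the
top scale. -/
lemma lintegral_sq_le_of_normH1Par_le (hd : d ≠ 0)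
    (h : normH1Par (timeInterval n) (spaceCube d n) w G T ≤ 1) :
    ∫⁻ t in timeInterval n, ∫⁻ x in spaceCube d n, ‖w (t, x)‖ₑ ^ 2 ≤
      ENNReal.ofReal ((3 ^ n) ^ 2) * volume (parCyl d n) := by
  have h1 := le_mul_of_laverage_rpow_half_le_one (volume_timeInterval_ne_zero n)
    (volume_timeInterval_ne_top n) (le_self_add.trans h)
  rw [volume_parCyl, mul_comm (volume (timeInterval n)), ← mul_assoc]
  refine le_trans ?_ (mul_le_mul_right h1 _)
  rw [← lintegral_const_mul' _ _ (ENNReal.mul_ne_top ENNReal.ofReal_ne_top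
    (volume_spaceCube_ne_top d n))]
  refine lintegral_mono fun t => ?_
  have e : volume (spaceCube d n) ^ (-(1 / (d : ℝ))) = (ENNReal.ofReal (3 ^ n))⁻¹ := by
    rw [volume_spaceCube, ENNReal.ofReal_rpow_of_pos (by positivity), ← Real.rpow_natCast,
      ← Real.rpow_mul (by positivity), mul_neg, mul_one_div_cancel (by exact_mod_cast hd),
      Real.rpow_neg_one, ENNReal.ofReal_inv_of_pos (by positivity)]
  have h2 : ((ENNReal.ofReal (3 ^ n))⁻¹ * normL2 (spaceCube d n) (fun x => w (t, x))) ^ 2 ≤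
      normH1 (spaceCube d n) (fun x => w (t, x)) (fun x => G (t, x)) ^ 2 := by
    gcongr
    rw [← e]
    exact le_self_add
  rw [mul_pow, normL2_sq] at h2
  have h3 : ENNReal.ofReal (3 ^ n) ^ 2 * (ENNReal.ofReal (3 ^ n))⁻¹ ^ 2 = 1 := by
    rw [← mul_pow, ENNReal.mul_inv_cancel (by simp) ENNReal.ofReal_ne_top, one_pow]
  calc _ = ENNReal.ofReal ((3 ^ n) ^ 2) * volume (spaceCube d n) *
        ((ENNReal.ofReal (3 ^ n))⁻¹ ^ 2 *
        ((volume (spaceCube d n))⁻¹ * ∫⁻ x in spaceCube d n, ‖w (t, x)‖ₑ ^ 2)) := by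
        rw [ENNReal.ofReal_pow (by positivity), mul_mul_mul_comm, h3, one_mul, ← mul_assoc,
          ENNReal.mul_inv_cancel (volume_spaceCube_ne_zero d n)
          (volume_spaceCube_ne_top d n), one_mul]
    _ ≤ _ := by gcongr

end Normalization

/-! ### Approximation by functions constant on cells -/

/-- The index of the cell of scale `m` containing a point. -/
def cellIndex (d m : ℕ) (p : SpaceTime d) : ℤ × (Fin d → ℤ) :=
  (round (p.1 / 3 ^ (2 * m)), fun i => round (p.2 i / 3 ^ m))

lemma cellIndex_of_mem {d m : ℕ} {q : ℤ × (Fin d → ℤ)} {p : SpaceTime d} (hp : p ∈ parCell d m q) :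
    cellIndex d m p = q :=
  Prod.ext (round_of_mem_gridInterval (by positivity) hp.1)
    (funext fun i => round_of_mem_gridInterval (by positivity) (hp.2 i))

lemma measurable_round_real : Measurable (round : ℝ → ℤ) := by
  have : (round : ℝ → ℤ) = fun x => ⌊x + 1 / 2⌋ := funext fun x => round_eq x
  rw [this]
  exact Int.measurable_floor.comp (measurable_id.add_const _)

lemma measurable_cellIndex (d m : ℕ) : Measurable (cellIndex d m) := by
  refine Measurable.prodMk ?_ (measurable_pi_lambda _ fun i => ?_)
  · exact measurable_round_real.comp (measurable_fst.div_const _)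
  · refine measurable_round_real.comp (Measurable.div_const ?_ _)
    exact ((by fun_prop : Continuous fun v : Space d => v i).measurable).comp measurable_snd

lemma measurable_comp_cellIndex {d m : ℕ} (a : ℤ × (Fin d → ℤ) → ℝ) :
    Measurable fun p => a (cellIndex d m p) :=
  (measurable_of_countable a).comp (measurable_cellIndex d m)

/-- A function that is close to functions of time on each spatial cell, each of which is close to
constants on time cells, is close to a function constant on cells. -/
lemma lintegral_sub_cell_constant_le {d m n : ℕ} (hmn : m ≤ n) {w : SpaceTime d → ℝ}
    (hw : MemLp w 2 (volume.restrict (parCyl d n))) (a : ℤ × (Fin d → ℤ) → ℝ)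
    {F : (Fin d → ℤ) → ℝ → ℝ}
    (hF : ∀ k, AEStronglyMeasurable (F k) (volume.restrict (timeInterval n))) :
    ∫⁻ p in parCyl d n, ‖w p - a (cellIndex d m p)‖ₑ ^ 2 ≤
      2 * (∫⁻ t in timeInterval n, ∑ k ∈ Fintype.piFinset fun _ : Fin d => centeredInts (n - m),
        ∫⁻ x in gridCube d (3 ^ m) k, ‖w (t, x) - F k t‖ₑ ^ 2) +
      2 * (ENNReal.ofReal ((3 ^ m) ^ d) *
        ∑ k ∈ Fintype.piFinset fun _ : Fin d => centeredInts (n - m),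
          ∑ j ∈ centeredInts (2 * (n - m)), ∫⁻ t in gridInterval (3 ^ (2 * m)) j,
            ‖F k t - a (j, k)‖ₑ ^ 2) := by
  set S := Fintype.piFinset fun _ : Fin d => centeredInts (n - m)
  have hTx := isTiling_spaceCube d hmn
  have hTt := isTiling_timeInterval hmn
  have hρ : (0 : ℝ) < 3 ^ (2 * m) := by positivity
  have hr : (0 : ℝ) < 3 ^ m := by positivity
  have hw' := hw
  rw [restrict_parCyl] at hw'
  have hmeas : AEMeasurable (fun p : SpaceTime d => ‖w p - a (cellIndex d m p)‖ₑ ^ 2)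
      (volume.restrict (parCyl d n)) :=
    ((hw.1.sub (measurable_comp_cellIndex a).aestronglyMeasurable).enorm).pow_const 2
  have hFa : ∀ k, AEMeasurable (fun t => ‖F k t - a (round (t / 3 ^ (2 * m)), k)‖ₑ ^ 2)
      (volume.restrict (timeInterval n)) := by
    intro k
    refine (((hF k).sub (Measurable.aestronglyMeasurable ?_)).enorm).pow_const 2
    exact (measurable_of_countable fun j => a (j, k)).comp
      (measurable_round_real.comp (measurable_id.div_const _))
  rw [restrict_parCyl] at hmeas ⊢
  rw [lintegral_prod _ hmeas]
  calc ∫⁻ t in timeInterval n, ∫⁻ x in spaceCube d n, ‖w (t, x) - a (cellIndex d m (t, x))‖ₑ ^ 2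
      ≤ ∫⁻ t in timeInterval n, (2 * ∑ k ∈ S,
          ∫⁻ x in gridCube d (3 ^ m) k, ‖w (t, x) - F k t‖ₑ ^ 2) +
          2 * (ENNReal.ofReal ((3 ^ m) ^ d) *
            ∑ k ∈ S, ‖F k t - a (round (t / 3 ^ (2 * m)), k)‖ₑ ^ 2) := by
        refine lintegral_mono_ae ?_
        filter_upwards [ae_memLp_slice hw'] with t ht
        rw [hTx.lintegral_eq, Finset.mul_sum, Finset.mul_sum, Finset.mul_sum,
          ← Finset.sum_add_distrib]
        refine Finset.sum_le_sum fun k hk => ?_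
        -- For fixed `t`, the cell index is constant on each spatial cell, so `F k t` can be
        -- inserted between `w` and a constant.
        have h1 : ∫⁻ x in gridCube d (3 ^ m) k, ‖w (t, x) - a (cellIndex d m (t, x))‖ₑ ^ 2 =
            ∫⁻ x in gridCube d (3 ^ m) k, ‖w (t, x) - a (round (t / 3 ^ (2 * m)), k)‖ₑ ^ 2 := by
          refine setLIntegral_congr_fun (isOpen_gridCube _ _ _).measurableSet fun x hx => ?_
          have : cellIndex d m (t, x) = (round (t / 3 ^ (2 * m)), k) :=
            Prod.ext rfl (funext fun i => round_of_mem_gridInterval hr (hx i))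
          simp only [this]
        have hwm : AEStronglyMeasurable (fun x => w (t, x))
            (volume.restrict (gridCube d (3 ^ m) k)) :=
          ht.1.mono_measure (Measure.restrict_mono_set _ (hTx.subset k hk))
        rw [h1]
        refine (lintegral_enorm_sub_sq_le (g := fun _ => F k t)
          (hwm.sub aestronglyMeasurable_const)).trans ?_
        rw [setLIntegral_const, volume_gridCube d hr.le, mul_comm (‖_‖ₑ ^ 2)]
    _ = 2 * (∫⁻ t in timeInterval n, ∑ k ∈ S,
          ∫⁻ x in gridCube d (3 ^ m) k, ‖w (t, x) - F k t‖ₑ ^ 2) +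
        2 * (ENNReal.ofReal ((3 ^ m) ^ d) * ∑ k ∈ S,
          ∫⁻ t in timeInterval n, ‖F k t - a (round (t / 3 ^ (2 * m)), k)‖ₑ ^ 2) := by
        rw [lintegral_add_right', lintegral_const_mul' _ _ (by simp),
          lintegral_const_mul' _ _ (by simp), lintegral_const_mul' _ _ ENNReal.ofReal_ne_top,
          lintegral_finsetSum' _ fun k _ => hFa k]
        exact ((Finset.aemeasurable_fun_sum _ fun k _ => hFa k).const_mul _).const_mul _
    _ = _ := by
        congr 3
        refine Finset.sum_congr rfl fun k _ => ?_
        rw [hTt.lintegral_eq]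
        refine Finset.sum_congr rfl fun j _ => ?_
        refine setLIntegral_congr_fun (isOpen_gridInterval _ _).measurableSet fun t ht => ?_
        simp only [round_of_mem_gridInterval hρ ht]

lemma memLp_apply {X E : Type*} [MeasurableSpace X] {μ : Measure X} [NormedAddCommGroup E]
    [NormedSpace ℝ E] {T : X → E →L[ℝ] ℝ} {p : ℝ≥0∞} (hT : MemLp T p μ) (v : E) :
    MemLp (fun t => T t v) p μ :=
  (ContinuousLinearMap.apply ℝ ℝ v).comp_memLp' hT

/-- A function in the unit ball of `H¹_par` is approximated by functions constant on the cells of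
scale `m`, up to an error of order `3 ^ m`. -/
lemma exists_cell_approximation {d : ℕ} (hd : d ≠ 0) : ∃ C : ℝ, 0 < C ∧ ∀ m n : ℕ, m ≤ n →
    ∀ (w : SpaceTime d → ℝ) (G : SpaceTime d → Space d) (T : ℝ → Hminus1 (spaceCube d n)),
    IsH1Par (timeInterval n) (spaceCube d n) w G T →
    normH1Par (timeInterval n) (spaceCube d n) w G T ≤ 1 →
    ∃ a : ℤ × (Fin d → ℤ) → ℝ, ∫⁻ p in parCyl d n, ‖w p - a (cellIndex d m p)‖ₑ ^ 2 ≤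
      ENNReal.ofReal (C * (3 ^ m) ^ 2) * volume (parCyl d n) := by
  classical
  obtain ⟨M, hM, hex⟩ := exists_rescaled_test_function d
  -- Twice the spatial constant, plus `2 * 2 * 4 * M ^ 2` from the splitting, the time Poincaré
  -- inequality and the duality bound.
  refine ⟨2 * (M ^ 2 * 2 ^ d * d) + 16 * M ^ 2, by positivity, fun m n hmn w G T hw hn => ?_⟩
  set r : ℝ := 3 ^ m with hr
  have hr0 : 0 < r := by positivity
  have hρ : (3 : ℝ) ^ (2 * m) = r ^ 2 := by rw [hr, ← pow_mul, mul_comm]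
  choose ψ₀ hψ₀ hψ₀1 hψ₀M hψ₀G using hex r hr0
  set S := Fintype.piFinset fun _ : Fin d => centeredInts (n - m) with hS
  have hTx := isTiling_spaceCube d hmn
  have hTt := isTiling_timeInterval hmn
  -- Extension by zero outside the index set makes every `ψ k` a test function of the large cube, so
  -- `toH10` is available for all `k`.
  let ψ : (Fin d → ℤ) → Space d → ℝ := fun k => if k ∈ S then ψ₀ k else 0
  have hψS : ∀ k ∈ S, ψ k = ψ₀ k := fun k hk => if_pos hk
  have hψU : ∀ k, IsTestFunction (spaceCube d n) (ψ k) := by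
    intro k
    by_cases hk : k ∈ S
    · rw [hψS k hk]
      exact (hψ₀ k).mono (hTx.subset k hk)
    · simp only [ψ, if_neg hk]
      exact isTestFunction_zero _
  have hψM : ∀ k x, ‖ψ k x‖ ≤ M * (r ^ d)⁻¹ := by
    intro k x
    by_cases hk : k ∈ S
    · rw [hψS k hk]
      exact hψ₀M k x
    · simp only [ψ, if_neg hk, Pi.zero_apply, norm_zero]
      positivity
  have hψG : ∀ k x, ‖gradient (ψ k) x‖ ≤ M * (r ^ d)⁻¹ * r⁻¹ := by
    intro k x
    by_cases hk : k ∈ S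
    · rw [hψS k hk]
      exact hψ₀G k x
    · have : gradient (0 : Space d → ℝ) x = 0 := by simp [gradient]
      simp only [ψ, if_neg hk, this, norm_zero]
      positivity
  have hwL := hw.memLp
  have hGL := hw.memLp_grad
  rw [Measure.volume_eq_prod, ← Measure.prod_restrict] at hwL hGL
  let F : (Fin d → ℤ) → ℝ → ℝ := fun k t =>
    ∫ x in spaceCube d n, w (t, x) * (hψU k).toH10.1.fst x
  -- By `weak_time`, this is the weak derivative of `F k`.
  let D : (Fin d → ℤ) → ℝ → ℝ := fun k t => T t (hψU k).toH10
  have hF : ∀ k, MemLp (F k) 2 (volume.restrict (timeInterval n)) := fun k =>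
    memLp_integral_mul hwL (Lp.memLp _)
  have hD : ∀ k, MemLp (D k) 2 (volume.restrict (timeInterval n)) := fun k =>
    memLp_apply hw.memLp_time _
  have hFψ : ∀ k ∈ S, ∀ t, F k t = ∫ x in gridCube d r k, w (t, x) * ψ₀ k x := by
    intro k hk t
    rw [← setIntegral_eq_of_subset_of_forall_sdiff_eq_zero (isOpen_spaceCube d n).measurableSet
      (hTx.subset k hk) fun x hx => by rw [(hψ₀ k).zero_of_notMem hx.2, mul_zero]]
    refine integral_congr_ae ((hψU k).toH10_fst.mono fun x hx => ?_)
    rw [← hψS k hk]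
    exact congrArg (w (t, x) * ·) hx
  let a : ℤ × (Fin d → ℤ) → ℝ := fun q =>
    ∫ t in gridInterval (3 ^ (2 * m)) q.1, F q.2 t * (3 ^ (2 * m))⁻¹
  refine ⟨a, (lintegral_sub_cell_constant_le hmn hw.memLp a fun k => (hF k).1).trans ?_⟩
  have hspace : ∫⁻ t in timeInterval n, ∑ k ∈ S,
      ∫⁻ x in gridCube d r k, ‖w (t, x) - F k t‖ₑ ^ 2 ≤
        ENNReal.ofReal (M ^ 2 * 2 ^ d * d * r ^ 2) * volume (parCyl d n) := by
    refine le_trans ?_ (mul_le_mul_right (lintegral_gradient_sq_le hn) _)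
    rw [← lintegral_const_mul' _ _ ENNReal.ofReal_ne_top]
    refine lintegral_mono_ae ?_
    filter_upwards [ae_memLp_slice hwL, ae_memLp_slice hGL, hw.hasWeakGradient] with t h1 h2 h3
    rw [hTx.lintegral_eq, Finset.mul_sum]
    refine Finset.sum_le_sum fun k hk => ?_
    rw [hFψ k hk]
    exact lintegral_sub_weighted_average_le h1 h2 h3 (isOpen_spaceCube d n) hr0
      (hTx.subset k hk) hM (hψ₀ k) (hψ₀1 k) (hψ₀M k)
  have htime : ∑ k ∈ S, ∑ j ∈ centeredInts (2 * (n - m)),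
      ∫⁻ t in gridInterval (3 ^ (2 * m)) j,
        ‖F k t - a (j, k)‖ₑ ^ 2 ≤
      ENNReal.ofReal (2 * (r ^ 2) ^ 2) *
        (ENNReal.ofReal (4 * M ^ 2 * (r ^ d)⁻¹ * r⁻¹ ^ 2 * (3 ^ n) ^ d) *
          volume (timeInterval n)) := by
    calc _ ≤ ∑ k ∈ S, ENNReal.ofReal (2 * (r ^ 2) ^ 2) * ∫⁻ t in timeInterval n, ‖D k t‖ₑ ^ 2 := by
          refine Finset.sum_le_sum fun k _ => ?_
          rw [hTt.lintegral_eq, Finset.mul_sum]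
          refine Finset.sum_le_sum fun j hj => ?_
          rw [← hρ]
          exact lintegral_sub_time_average_le (isOpen_timeInterval n) (hF k) (hD k)
            (fun η hη => hw.weak_time η hη _) (by positivity) (hTt.subset j hj)
      _ = ENNReal.ofReal (2 * (r ^ 2) ^ 2) *
          ∫⁻ t in timeInterval n, ∑ k ∈ S, ‖D k t‖ₑ ^ 2 := by
          rw [← Finset.mul_sum, lintegral_finsetSum' _ fun k _ => (hD k).1.enorm.pow_const 2]
      _ ≤ _ := by
          refine mul_le_mul_right ?_ _
          refine le_trans ?_ (mul_le_mul_right (lintegral_normHminus1_sq_le hn) _)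
          rw [← lintegral_const_mul' _ _ ENNReal.ofReal_ne_top]
          refine lintegral_mono fun t => ?_
          exact sum_sq_apply_le hd hmn hM (fun k hk => (hψS k hk).symm ▸ hψ₀ k) hψU hψM hψG (T t)
  refine (add_le_add (mul_le_mul_right hspace _)
    (mul_le_mul_right (mul_le_mul_right htime _) _)).trans (le_of_eq ?_)
  rw [volume_parCyl, volume_spaceCube, volume_timeInterval]
  have h2 : (2 : ℝ≥0∞) = ENNReal.ofReal 2 := by simp
  rw [h2, ← ENNReal.ofReal_mul (by positivity), ← ENNReal.ofReal_mul (by positivity),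
    ← ENNReal.ofReal_mul (by positivity), ← ENNReal.ofReal_mul (by positivity),
    ← ENNReal.ofReal_mul (by positivity), ← ENNReal.ofReal_mul (by positivity),
    ← ENNReal.ofReal_mul (by positivity), ← ENNReal.ofReal_add (by positivity) (by positivity),
    ← ENNReal.ofReal_mul (by positivity)]
  congr 1
  field_simp
  ring

/-! ### Pairing with functions constant on cells -/

/-- For an odd ratio `2 * s + 1` no fine interval straddles a coarse boundary, and adding `s` before
the floor division rounds to the nearest coarse index. -/
lemma gridInterval_subset_coarser {r : ℝ} (hr : 0 < r) (s : ℕ) (j : ℤ) :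
    gridInterval r j ⊆ gridInterval (r * (2 * s + 1)) ((j + s) / (2 * s + 1)) := by
  rintro x ⟨h1, h2⟩
  set q : ℤ := 2 * s + 1 with hq
  have hq0 : 0 < q := by omega
  have h3 := Int.emod_nonneg (j + s) hq0.ne'
  have h4 := Int.emod_lt_of_pos (j + s) hq0
  have h5 := Int.mul_ediv_add_emod (j + s) q
  set j' := (j + s) / q
  have h6 : q * j' - s ≤ j := by omega
  have h7 : j ≤ q * j' + s := by omega
  have h6' : ((2 * s + 1 : ℝ)) * j' - s ≤ j := by rw [hq] at h6; exact_mod_cast h6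
  have h7' : (j : ℝ) ≤ (2 * s + 1 : ℝ) * j' + s := by rw [hq] at h7; exact_mod_cast h7
  have h8 := mul_le_mul_of_nonneg_left h6' hr.le
  have h9 := mul_le_mul_of_nonneg_left h7' hr.le
  constructor <;> nlinarith

/-- One step of scale multiplies lengths by 9 in time and 3 in space, hence `s = 4` and `s = 1`. The
coarse index is thus a function of the fine one. -/
lemma cellIndex_succ_of_mem {d m : ℕ} {q : ℤ × (Fin d → ℤ)} {p : SpaceTime d}
    (hp : p ∈ parCell d m q) :
    cellIndex d (m + 1) p = ((q.1 + 4) / 9, fun i => (q.2 i + 1) / 3) := by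
  refine cellIndex_of_mem ⟨?_, fun i => ?_⟩
  · have h := gridInterval_subset_coarser (by positivity) 4 q.1 hp.1
    have e : (3 : ℝ) ^ (2 * (m + 1)) = 3 ^ (2 * m) * (2 * (4 : ℕ) + 1) := by
      rw [mul_add, pow_add]; norm_num
    rw [e]
    exact h
  · have h := gridInterval_subset_coarser (by positivity) 1 (q.2 i) (hp.2 i)
    have e : (3 : ℝ) ^ (m + 1) = 3 ^ m * (2 * (1 : ℕ) + 1) := by
      rw [pow_succ]; norm_num
    rw [e]
    exact h

lemma enorm_setAverage_mul_le {X : Type*} [MeasureSpace X] {V : Set X} {f h : X → ℝ}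
    (hf : AEStronglyMeasurable f (volume.restrict V))
    (hh : AEStronglyMeasurable h (volume.restrict V)) (h0 : volume V ≠ 0) (ht : volume V ≠ ⊤) :
    ‖⨍ p in V, f p * h p‖ₑ ≤ normL2 V f * normL2 V h := by
  have hpos : 0 < volume.real V := ENNReal.toReal_pos h0 ht
  have e : ‖(volume.real V)⁻¹‖ₑ = (volume V)⁻¹ := by
    rw [← ofReal_norm, Real.norm_of_nonneg (by positivity), ENNReal.ofReal_inv_of_pos hpos,
      measureReal_def, ENNReal.ofReal_toReal ht]
  refine (ENNReal.pow_le_pow_left_iff two_ne_zero).1 ?_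
  rw [setAverage_eq, enorm_smul, mul_pow, mul_pow, normL2_sq, normL2_sq, e, mul_mul_mul_comm,
    ← sq]
  gcongr
  exact enorm_integral_mul_sq_le hf hh

lemma rmsAverages_nonneg (d m n : ℕ) (f : SpaceTime d → ℝ) : 0 ≤ rmsAverages d m n f := by
  unfold rmsAverages
  exact Real.sqrt_nonneg _

/-- On each cell `h` factors out and leaves the average of `f`; the discrete Cauchy–Schwarz
inequality over the equal-volume cells concludes. -/
lemma enorm_setAverage_mul_cell_constant_le {d m n : ℕ} (hmn : m ≤ n) {f h : SpaceTime d → ℝ}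
    (hf : MemLp f 2 (volume.restrict (parCyl d n)))
    (hh : MemLp h 2 (volume.restrict (parCyl d n))) (b : ℤ × (Fin d → ℤ) → ℝ)
    (hb : ∀ q, ∀ p ∈ parCell d m q, h p = b q) :
    ‖⨍ p in parCyl d n, f p * h p‖ₑ ≤ ENNReal.ofReal (rmsAverages d m n f) *
      normL2 (parCyl d n) h := by
  have hT := isTiling_parCyl d hmn
  set S := cellIndices d m n with hS
  set V := parCyl d n with hV
  set v : ℝ := volume.real (parCyl d m) with hv
  have hv0 : 0 < v := ENNReal.toReal_pos (volume_parCyl_ne_zero d m) (volume_parCyl_ne_top d m)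
  have hvc : ∀ q, volume (parCell d m q) = ENNReal.ofReal v := fun q => by
    rw [volume_parCell, hv, measureReal_def, ENNReal.ofReal_toReal (volume_parCyl_ne_top d m)]
  have hvV : volume V = ENNReal.ofReal (S.card * v) := by
    rw [← hT.sum_volume]
    simp_rw [hvc]
    rw [Finset.sum_const, nsmul_eq_mul, ENNReal.ofReal_mul (by positivity), ENNReal.ofReal_natCast]
  have hN0 : (0 : ℝ) < S.card := by
    have h1 := volume_parCyl_ne_zero d n
    rw [← hV, hvV] at h1
    by_contra h2
    have h3 : (S.card : ℝ) = 0 := le_antisymm (not_lt.1 h2) (Nat.cast_nonneg _)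
    exact h1 (by rw [h3]; simp)
  have e1 : ⨍ p in V, f p * h p = (S.card : ℝ)⁻¹ * ∑ q ∈ S, b q * ⨍ p in parCell d m q, f p := by
    have hi : IntegrableOn (fun p => f p * h p) V := hf.integrable_mul hh
    rw [setAverage_eq, hT.integral_eq hi, measureReal_def, hvV,
      ENNReal.toReal_ofReal (by positivity), mul_inv, smul_eq_mul, mul_assoc, Finset.mul_sum]
    congr 1
    refine Finset.sum_congr rfl fun q hq => ?_
    have e2 : ∫ p in parCell d m q, f p * h p = (∫ p in parCell d m q, f p) * b q := by
      rw [← integral_mul_const]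
      exact setIntegral_congr_fun (measurableSet_parCell d m q) fun p hp => by
        simp only [hb q p hp]
    rw [e2, setAverage_eq, measureReal_def, hvc, ENNReal.toReal_ofReal hv0.le, smul_eq_mul]
    ring
  have e3 : normL2 V h ^ 2 = ENNReal.ofReal ((S.card : ℝ)⁻¹ * ∑ q ∈ S, b q ^ 2) := by
    have e4 : ∀ q ∈ S, ∫⁻ p in parCell d m q, ‖h p‖ₑ ^ 2 = ENNReal.ofReal (v * b q ^ 2) := by
      intro q _
      rw [setLIntegral_congr_fun (g := fun _ => ‖b q‖ₑ ^ 2) (measurableSet_parCell d m q)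
        fun p hp => by simp only [hb q p hp], setLIntegral_const, hvc, ← ofReal_norm,
        ← ENNReal.ofReal_pow (norm_nonneg _), ← ENNReal.ofReal_mul (by positivity),
        Real.norm_eq_abs, sq_abs, mul_comm]
    rw [normL2_sq, hT.lintegral_eq, Finset.sum_congr rfl e4,
      ← ENNReal.ofReal_sum_of_nonneg fun q _ => by positivity, hvV,
      ← ENNReal.ofReal_inv_of_pos (by positivity), ← ENNReal.ofReal_mul (by positivity),
      ← Finset.mul_sum]
    congr 1
    field_simp
  refine (ENNReal.pow_le_pow_left_iff two_ne_zero).1 ?_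
  rw [mul_pow, e3, ← ENNReal.ofReal_pow (rmsAverages_nonneg d m n f), rmsAverages_sq d hmn, ← hS,
    ← ENNReal.ofReal_mul (mul_nonneg (by positivity) (Finset.sum_nonneg fun _ _ => sq_nonneg _)),
    ← ofReal_norm, ← ENNReal.ofReal_pow (norm_nonneg _),
    Real.norm_eq_abs, sq_abs, e1, mul_pow]
  refine ENNReal.ofReal_le_ofReal ?_
  have hcs := Finset.sum_mul_sq_le_sq_mul_sq S b fun q => ⨍ p in parCell d m q, f p
  calc _ ≤ (S.card : ℝ)⁻¹ ^ 2 * ((∑ q ∈ S, b q ^ 2) *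
        ∑ q ∈ S, (⨍ p in parCell d m q, f p) ^ 2) := by gcongr
    _ = _ := by ring

end

/-! ### The telescoping over scales -/

theorem proposition3p4 (d : ℕ) (hd : 2 ≤ d) :
    ∃ C : ℝ≥0, ∀ n : ℕ, 1 ≤ n → ∀ f : SpaceTime d → ℝ,
      MemLp f 2 (volume.restrict (parCyl d n)) →
        normHhatMinus1Par (timeInterval n) (spaceCube d n) f ≤
          (C : ℝ≥0∞) * normL2 (parCyl d n) f +
            (C : ℝ≥0∞) * ∑ m ∈ Finset.range n,
              (3 : ℝ≥0∞) ^ m * ENNReal.ofReal (rmsAverages d m n f) := by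
  have hd0 : d ≠ 0 := by omega
  obtain ⟨C, hC, happrox⟩ := exists_cell_approximation hd0
  -- `C` serves the scales below `n`, and `1` serves the zero approximation at scale `n`.
  set B : ℝ := max C 1 with hB
  have hB0 : 0 < B := by positivity
  -- The factor 20 is `2 * 1 + 2 * 9`, from comparing `g m` and `g (m + 1)` through `w`.
  refine ⟨Real.toNNReal (Real.sqrt (20 * B)), fun n hn f hf => ?_⟩
  change _ ≤ ENNReal.ofReal _ * _ + ENNReal.ofReal _ * _
  set K : ℝ := Real.sqrt (20 * B) with hK
  have hK2 : K ^ 2 = 20 * B := Real.sq_sqrt (by positivity)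
  rw [normHhatMinus1Par]
  refine iSup_le fun w => iSup_le fun G => iSup_le fun T => iSup_le fun hw => iSup_le fun hw1 => ?_
  change ENNReal.ofReal (⨍ p in parCyl d n, f p * w p) ≤ _
  set V := parCyl d n with hV
  have hV0 : volume V ≠ 0 := volume_parCyl_ne_zero d n
  have hVt : volume V ≠ ⊤ := volume_parCyl_ne_top d n
  have hwV : MemLp w 2 (volume.restrict V) := hw.memLp
  choose a ha using fun m (hmn : m < n) => happrox m n hmn.le w G T hw hw1
  -- The default value matters: it makes `g n = 0`, which closes the telescoping sum.
  let b : ℕ → ℤ × (Fin d → ℤ) → ℝ := fun m => if hmn : m < n then a m hmn else 0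
  let g : ℕ → SpaceTime d → ℝ := fun m p => b m (cellIndex d m p)
  have hgn : g n = 0 := by
    funext p
    simp [g, b]
  have hgm : ∀ m, AEStronglyMeasurable (g m) (volume.restrict V) := fun m =>
    (measurable_comp_cellIndex (b m)).aestronglyMeasurable
  have hdist : ∀ m ≤ n, ∫⁻ p in V, ‖w p - g m p‖ₑ ^ 2 ≤
      ENNReal.ofReal (B * (3 ^ m) ^ 2) * volume V := by
    intro m hm
    rcases hm.lt_or_eq with hm | rfl
    · have e : g m = fun p => a m hm (cellIndex d m p) := by
        funext p
        simp [g, b, hm]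
      rw [e]
      refine (ha m hm).trans ?_
      gcongr
      exact le_max_left _ _
    · have h1 := lintegral_sq_le_of_normH1Par_le hd0 hw1
      have hwV' := hwV
      rw [hV, restrict_parCyl] at hwV'
      rw [lintegral_lintegral_enorm_sq hwV', ← restrict_parCyl] at h1
      simp only [hgn, Pi.zero_apply, sub_zero]
      refine h1.trans ?_
      gcongr
      exact le_mul_of_one_le_left (by positivity) (le_max_right _ _)
  have hwg : ∀ m ≤ n, MemLp (w - g m) 2 (volume.restrict V) := fun m hm =>
    memLp_two_of_lintegral_ne_top (hwV.1.sub (hgm m))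
      (ne_top_of_le_ne_top (ENNReal.mul_ne_top ENNReal.ofReal_ne_top hVt) (hdist m hm))
  have hdiff : ∀ m ∈ Finset.range n, MemLp (g m - g (m + 1)) 2 (volume.restrict V) := by
    intro m hm
    have hm := Finset.mem_range.1 hm
    simpa using (hwg (m + 1) hm).sub (hwg m hm.le)
  have hle : ∀ x : ℝ≥0∞, ∀ y : ℝ, 0 ≤ y → x ^ 2 ≤ ENNReal.ofReal (y ^ 2) → x ≤ ENNReal.ofReal y := by
    intro x y hy hxy
    rw [ENNReal.ofReal_pow hy] at hxy
    exact (ENNReal.pow_le_pow_left_iff two_ne_zero).1 hxy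
  have hfirst : normL2 V (w - g 0) ≤ ENNReal.ofReal K := by
    refine hle _ _ (Real.sqrt_nonneg _) ?_
    rw [normL2_sq, ENNReal.inv_mul_le_iff hV0 hVt, mul_comm]
    refine (hdist 0 (Nat.zero_le n)).trans ?_
    gcongr
    rw [hK2]
    simp only [pow_zero, one_pow, mul_one]
    linarith
  have hstep : ∀ m ∈ Finset.range n, normL2 V (g m - g (m + 1)) ≤ ENNReal.ofReal (K * 3 ^ m) := by
    intro m hm
    have hm := Finset.mem_range.1 hm
    refine hle _ _ (by positivity) ?_
    rw [normL2_sq, ENNReal.inv_mul_le_iff hV0 hVt, mul_comm]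
    calc ∫⁻ p in V, ‖(g m - g (m + 1)) p‖ₑ ^ 2
        ≤ 2 * (∫⁻ p in V, ‖g m p - w p‖ₑ ^ 2) + 2 * (∫⁻ p in V, ‖w p - g (m + 1) p‖ₑ ^ 2) :=
          lintegral_enorm_sub_sq_le (h := g (m + 1)) ((hgm m).sub hwV.1)
      _ ≤ 2 * (ENNReal.ofReal (B * (3 ^ m) ^ 2) * volume V) +
          2 * (ENNReal.ofReal (B * (3 ^ (m + 1)) ^ 2) * volume V) := by
          refine add_le_add (mul_le_mul_right ?_ _) (mul_le_mul_right (hdist (m + 1) hm) _)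
          refine le_trans (le_of_eq (lintegral_congr fun p => ?_)) (hdist m hm.le)
          rw [← enorm_neg, neg_sub]
      _ = ENNReal.ofReal ((K * 3 ^ m) ^ 2) * volume V := by
          rw [← mul_assoc, ← mul_assoc, ← add_mul]
          congr 1
          have h2 : (2 : ℝ≥0∞) = ENNReal.ofReal 2 := by simp
          rw [h2, ← ENNReal.ofReal_mul (by positivity), ← ENNReal.ofReal_mul (by positivity),
            ← ENNReal.ofReal_add (by positivity) (by positivity), mul_pow, hK2]
          congr 1
          ring
  have htel : ⨍ p in V, f p * w p = (⨍ p in V, f p * (w - g 0) p) +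
      ∑ m ∈ Finset.range n, ⨍ p in V, f p * (g m - g (m + 1)) p := by
    have i1 : Integrable (fun p => f p * (w - g 0) p) (volume.restrict V) :=
      hf.integrable_mul (hwg 0 (Nat.zero_le n))
    have i2 : ∀ m ∈ Finset.range n,
        Integrable (fun p => f p * (g m - g (m + 1)) p) (volume.restrict V) := fun m hm =>
      hf.integrable_mul (hdiff m hm)
    simp_rw [setAverage_eq]
    rw [← Finset.smul_sum, ← smul_add, ← integral_finsetSum _ i2,
      ← integral_add i1 (integrable_finsetSum _ i2)]
    congr 2 with p
    rw [← Finset.mul_sum, ← mul_add]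
    simp only [Pi.sub_apply]
    rw [Finset.sum_range_sub' (fun m => g m p) n, hgn]
    simp
  have hcell : ∀ m ∈ Finset.range n, ‖⨍ p in V, f p * (g m - g (m + 1)) p‖ₑ ≤
      ENNReal.ofReal K * (3 ^ m * ENNReal.ofReal (rmsAverages d m n f)) := by
    intro m hm
    refine (enorm_setAverage_mul_cell_constant_le (Finset.mem_range.1 hm).le hf (hdiff m hm)
      -- The value on a fine cell: its own constant minus that of the unique coarse cell containing
      -- it.
      (fun q => b m q - b (m + 1) ((q.1 + 4) / 9, fun i => (q.2 i + 1) / 3)) ?_).trans ?_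
    · intro q p hp
      simp only [Pi.sub_apply, g, cellIndex_of_mem hp, cellIndex_succ_of_mem hp]
    · refine (mul_le_mul_right (hstep m hm) _).trans (le_of_eq ?_)
      rw [ENNReal.ofReal_mul (Real.sqrt_nonneg _), ENNReal.ofReal_pow (by norm_num)]
      simp only [ENNReal.ofReal_ofNat]
      ring
  calc ENNReal.ofReal (⨍ p in V, f p * w p) ≤ ‖⨍ p in V, f p * w p‖ₑ := by
        rw [← ofReal_norm]
        exact ENNReal.ofReal_le_ofReal (Real.le_norm_self _)
    _ ≤ ‖⨍ p in V, f p * (w - g 0) p‖ₑ +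
        ∑ m ∈ Finset.range n, ‖⨍ p in V, f p * (g m - g (m + 1)) p‖ₑ := by
        rw [htel]
        refine (enorm_add_le _ _).trans ?_
        gcongr
        exact enorm_sum_le _ _
    _ ≤ _ := by
        refine add_le_add ?_ ?_
        · refine (enorm_setAverage_mul_le hf.1 (hwg 0 (Nat.zero_le n)).1 hV0 hVt).trans ?_
          rw [mul_comm]
          gcongr
        · rw [Finset.mul_sum]
          exact Finset.sum_le_sum hcell
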